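/- Let $G=N\rtimes H$ be a finite group with $N$ abelian. A \emph{supercharacter theory} of a finite group is a pair $(\mathcal K,\mathcal X)$, where $\mathcal K$ is a partition of the group into unions of conjugacy classes (superclasses) and $\mathcal X$ is a set of characters (supercharacters) with $|\mathcal X|=|\mathcal K|$, such that the characters in $\mathcal X$ are constant on the blocks of $\mathcal K$ and each irreducible character is a constituent of exactly one character in $\mathcal X$. A superclass function is a complex function constant on superclasses. One supercharacter theory is (not necessarily strictly) \emph{coarser} than another if each of its superclasses is a union of superclasses of the other. Write $g^h=h^{-1}gh$ and, for a function $\alpha$, $\alpha^h(g)=\alpha(hgh^{-1})$. Consider a sublattice $\mathcal L$ of the lattice of subgroups of $H$, each $K\in\mathcal L$ being equipped with a supercharacter theory, such that (L1) $H,\{1\}\in\mathcal L$; (L2) $\mathcal L$ is closed under conjugation by $H$; (L3)--(L4) for $K\le L$ in $\mathcal L$, induction from $K$ to $L$ and restriction from $L$ to $K$ send superclass functions to superclass functions, and if $\chi$ is a supercharacter of $K\in\mathcal L$ and $h\in H$ then $\chi^h$ is a supercharacter of $K^h$. Let $I_H(\psi)$ be the stabilizer of $\psi\in\operatorname{Irr}(N)$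 in $H$. Suppose that for each $\psi\in\operatorname{Irr}(N)$ a subgroup $H_\psi\in\mathcal L$ is chosen so that (H1) $H_\psi$ is a normal subgroup of $I_H(\psi)$; (H2) $H_{\psi^h}=(H_\psi)^h$ for all $h\in H$; (H3) $H_{1_N}=H$; (H4) $H_\psi\cap H_\varphi\subseteq H_{\psi\varphi}$ for all $\psi,\varphi\in\operatorname{Irr}(N)$. For $K\le I_H(\psi)$ and a character $\chi$ of $K$, let $\psi\rtimes\chi=\operatorname{Ind}_{NK}^{G}(\widetilde\psi\cdot\operatorname{Inf}_K^{NK}\chi)$, where $\widetilde\psi(nk)=\psi(n)$. For a set $S$ of representatives of the orbits of $G$ on $\operatorname{Irr}(N)$, the supercharacter theory of $G$ \emph{built from} $(\mathcal L,H_\psi)$ is the unique one whose set of supercharacters is $$\{\psi\rtimes\operatorname{Ind}_{H_\psi}^{I_H(\psi)}(\chi)\mid \psi\in S,\ \chi\text{ a supercharacter of }H_\psi\}.$$ Now let $\mathcal L'\subseteq\mathcal L$ be two sublattices of the subgroup lattice of $H$, each equipped with supercharacter theories satisfying (L1)--(L4), and let $(H'_\psi)$ (with $H'_\psi\in\mathcal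 L'$) and $(H_\psi)$ (with $H_\psi\in\mathcal L$) be choices satisfying (H1)--(H4). Suppose that 1. the supercharacter theory assigned to each $K\in\mathcal L'$ is (not necessarily strictly) coarser than the one assigned to $K$ as an element of $\mathcal L$; and 2. $H'_\psi\subseteq H_\psi$ for every $\psi\in\operatorname{Irr}(N)$. Then, for any choices of orbit representatives, the supercharacter theories of $G$ built from $(\mathcal L,H_\psi)$ and from $(\mathcal L',H'_\psi)$ exist and are unique, and the one built from $(\mathcal L',H'_\psi)$ is (not necessarily strictly) coarser than the one built from $(\mathcal L,H_\psi)$. -/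

import Mathlib

/-- `χ` is a (complex) character of `G`: the trace function of a representation of `G` on `ℂⁿ`,
`n > 0`. -/
def IsCharacter {G : Type*} [Group G] (χ : G → ℂ) : Prop :=
  ∃ n : ℕ, 0 < n ∧ ∃ ρ : Representation ℂ G (Fin n → ℂ), ρ.character = χ

/-- `χ` is an irreducible character of `G`, i.e. `χ ∈ Irr(G)`. -/
def IsIrreducibleCharacter {G : Type*} [Group G] (χ : G → ℂ) : Prop :=
  ∃ (n : ℕ) (ρ : Representation ℂ G (Fin n → ℂ)), ρ.IsIrreducible ∧ ρ.character = χ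

/-- The scalar product `⟨χ, η⟩ = |G|⁻¹ ∑ χ(g) η(g⁻¹)`; recall that `η(g⁻¹)` is the complex conjugate
of `η(g)` when `η` is a character of a finite group. -/
noncomputable def charInner {G : Type*} [Group G] (χ η : G → ℂ) : ℂ :=
  (Nat.card G : ℂ)⁻¹ * ∑ᶠ g : G, χ g * η g⁻¹

/-- The irreducible character `η` is a constituent of the character `χ`. -/
def IsConstituent {G : Type*} [Group G] (η χ : G → ℂ) : Prop :=
  charInner χ η ≠ 0

/-- A supercharacter theory of a (finite) group `G`: a partition of `G` into unions of conjugacy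
classes together with a set of characters. -/
@[ext]
structure SupercharacterTheory (G : Type*) [Group G] where
  superclasses : Set (Set G)
  supercharacters : Set (G → ℂ)
  isPartition : Setoid.IsPartition superclasses
  conj_mem : ∀ C ∈ superclasses, ∀ x ∈ C, ∀ g : G, g * x * g⁻¹ ∈ C
  isCharacter : ∀ χ ∈ supercharacters, IsCharacter χ
  encard_eq : supercharacters.encard = superclasses.encard
  constant : ∀ χ ∈ supercharacters, ∀ C ∈ superclasses, ∀ x ∈ C, ∀ y ∈ C, χ x = χ y
  existsUnique_constituent : ∀ η : G → ℂ, IsIrreducibleCharacter η →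
    ∃! χ : G → ℂ, χ ∈ supercharacters ∧ IsConstituent η χ

namespace SupercharacterTheory

variable {G : Type*} [Group G]

/-- A superclass function: a function that is constant on the superclasses. -/
def IsSuperclassFunction (T : SupercharacterTheory G) (f : G → ℂ) : Prop :=
  ∀ C ∈ T.superclasses, ∀ x ∈ C, ∀ y ∈ C, f x = f y

/-- `T₁` is (not necessarily strictly) coarser than `T₂`: every superclass of `T₂` lies in a
superclass of `T₁`, i.e. the superclasses of `T₁` are unions of superclasses of `T₂`. -/
def IsCoarser (T₁ T₂ : SupercharacterTheory G) : Prop :=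
  ∀ D ∈ T₂.superclasses, ∃ C ∈ T₁.superclasses, D ⊆ C

end SupercharacterTheory

open scoped Classical in
/-- The induced class function `Ind_K^G f (g) = |K|⁻¹ ∑ f(x g x⁻¹)`, where the sum is over the
`x ∈ G` with `x g x⁻¹ ∈ K`. -/
noncomputable def induce {G : Type*} [Group G] (K : Subgroup G) (f : K → ℂ) (g : G) : ℂ :=
  (Nat.card K : ℂ)⁻¹ * ∑ᶠ x : G, if h : x * g * x⁻¹ ∈ K then f ⟨x * g * x⁻¹, h⟩ else 0

/-- `Ind_K^L f` for subgroups `K ≤ L` of a group. -/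
noncomputable def induceBetween {G : Type*} [Group G] {K L : Subgroup G} (_ : K ≤ L)
    (f : K → ℂ) : L → ℂ :=
  induce (K.subgroupOf L) fun x => f ⟨x.1.1, Subgroup.mem_subgroupOf.1 x.2⟩

/-- `Res_K^L f` for subgroups `K ≤ L` of a group. -/
def restrictBetween {G : Type*} [Group G] {K L : Subgroup G} (hKL : K ≤ L) (f : L → ℂ) : K → ℂ :=
  fun x => f (Subgroup.inclusion hKL x)

/-- The conjugate subgroup `K^g = g⁻¹ K g = {x | g x g⁻¹ ∈ K}`. -/
def conjSubgroup {G : Type*} [Group G] (K : Subgroup G) (g : G) : Subgroup G :=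
  K.comap (MulAut.conj g).toMonoidHom

/-- The conjugate `f^g : K^g → ℂ`, `f^g(x) = f(g x g⁻¹)`, of a function `f : K → ℂ`. -/
def conjFunction {G : Type*} [Group G] {K : Subgroup G} (f : K → ℂ) (g : G) :
    conjSubgroup K g → ℂ :=
  fun x => f ⟨g * x.1 * g⁻¹, x.2⟩

/-- A lattice of subgroups of `H` (a sublattice of the lattice of all subgroups) containing `H` and
`1` and closed under conjugation, each of whose members is equipped with a supercharacter theory,
such that induction and restriction between members send superclass functions to superclass
functions, and conjugates of supercharacters are supercharacters of the conjugate subgroup. -/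
structure CompatibleLattice (H : Type*) [Group H] where
  lattice : Sublattice (Subgroup H)
  top_mem : ⊤ ∈ lattice
  bot_mem : ⊥ ∈ lattice
  conj_mem : ∀ K ∈ lattice, ∀ h : H, conjSubgroup K h ∈ lattice
  theory : ∀ K : Subgroup H, K ∈ lattice → SupercharacterTheory K
  induce_superclass : ∀ (K L : Subgroup H) (hK : K ∈ lattice) (hL : L ∈ lattice) (hKL : K ≤ L)
    (f : K → ℂ), (theory K hK).IsSuperclassFunction f →
      (theory L hL).IsSuperclassFunction (induceBetween hKL f)
  restrict_superclass : ∀ (K L : Subgroup H) (hK : K ∈ lattice) (hL : L ∈ lattice) (hKL : K ≤ L)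
    (f : L → ℂ), (theory L hL).IsSuperclassFunction f →
      (theory K hK).IsSuperclassFunction (restrictBetween hKL f)
  conj_supercharacter : ∀ (K : Subgroup H) (hK : K ∈ lattice) (h : H),
    ∀ χ ∈ (theory K hK).supercharacters,
      conjFunction χ h ∈ (theory (conjSubgroup K h) (conj_mem K hK h)).supercharacters

section Semidirect

variable {N H : Type*} [CommGroup N] [Group H] (φ : H →* MulAut N)

/-- For `ψ : N → ℂ` and `g ∈ G = N ⋊ H`, the conjugate `ψ^g(n) = ψ(g n g⁻¹)`. -/
def conjOnNormal (ψ : N → ℂ) (g : N ⋊[φ] H) : N → ℂ :=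
  fun n => ψ (g * SemidirectProduct.inl n * g⁻¹).left

/-- The inertial subgroup `I_H(ψ)`: the stabilizer of `ψ` in `H` under the conjugation action,
where `h n h⁻¹ = φ h n` in `N ⋊ H`. -/
def inertia (ψ : N → ℂ) : Subgroup H where
  carrier := {h | ∀ n, ψ (φ h n) = ψ n}
  one_mem' := by simp
  mul_mem' := by
    intro a b ha hb n
    rw [map_mul, MulAut.mul_apply, ha, hb]
  inv_mem' := by
    intro a ha n
    rw [← ha (φ a⁻¹ n), ← MulAut.mul_apply, ← map_mul, mul_inv_cancel, map_one, MulAut.one_apply]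

/-- `ψ ⋊ χ = Ind_{NK}^G(ψ̃ · Inf_K^{NK} χ)` for `K ≤ H` and `χ : K → ℂ`. Here `NK` is the preimage of
`K` in `G = N ⋊ H`, and the inflated product takes the value `ψ(n) χ(k)` at `nk`. -/
noncomputable def semidirectChar (ψ : N → ℂ) {K : Subgroup H} (χ : K → ℂ) : N ⋊[φ] H → ℂ :=
  induce (K.comap SemidirectProduct.rightHom) fun g => ψ g.1.left * χ ⟨g.1.right, g.2⟩

/-- A choice of subgroups `H_ψ` in the lattice for `ψ ∈ Irr(N)` (the values at functions `ψ` that are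
not irreducible characters of `N` are irrelevant) such that `H_ψ` is a normal subgroup of `I_H(ψ)`,
`H_{ψ^h} = (H_ψ)^h`, `H_{1_N} = H` and `H_ψ ∩ H_η ≤ H_{ψη}`. -/
structure LittleGroupChoice (𝓛 : CompatibleLattice H) where
  subgroup : (N → ℂ) → Subgroup H
  mem : ∀ ψ, IsIrreducibleCharacter ψ → subgroup ψ ∈ 𝓛.lattice
  le_inertia : ∀ ψ, IsIrreducibleCharacter ψ → subgroup ψ ≤ inertia φ ψ
  normal : ∀ ψ, IsIrreducibleCharacter ψ → ((subgroup ψ).subgroupOf (inertia φ ψ)).Normal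
  conj : ∀ ψ, IsIrreducibleCharacter ψ → ∀ h : H,
    subgroup (conjOnNormal φ ψ (SemidirectProduct.inr h)) = conjSubgroup (subgroup ψ) h
  one : subgroup 1 = ⊤
  inf_le : ∀ ψ η, IsIrreducibleCharacter ψ → IsIrreducibleCharacter η →
    subgroup ψ ⊓ subgroup η ≤ subgroup (ψ * η)

/-- `S` is a set of orbit representatives of `Irr(N)` under the conjugation action of `N ⋊ H`. -/
def IsOrbitTransversal (S : Set (N → ℂ)) : Prop :=
  (∀ ψ ∈ S, IsIrreducibleCharacter ψ) ∧
    ∀ η : N → ℂ, IsIrreducibleCharacter η →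
      ∃! ψ : N → ℂ, ψ ∈ S ∧ ∃ g : N ⋊[φ] H, conjOnNormal φ ψ g = η

variable {φ} {𝓛 : CompatibleLattice H}

/-- `S_ψ = {Ind_{H_ψ}^{I_H(ψ)} χ | χ a supercharacter of H_ψ}`. -/
def LittleGroupChoice.inducedSupercharacters (A : LittleGroupChoice φ 𝓛) (ψ : N → ℂ)
    (hψ : IsIrreducibleCharacter ψ) : Set (inertia φ ψ → ℂ) :=
  {θ | ∃ χ ∈ (𝓛.theory (A.subgroup ψ) (A.mem ψ hψ)).supercharacters,
    θ = induceBetween (A.le_inertia ψ hψ) χ}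

/-- The set `{ψ ⋊ χ | ψ ∈ S, χ ∈ S_ψ}` of characters of `G = N ⋊ H`. -/
def LittleGroupChoice.characters (A : LittleGroupChoice φ 𝓛) (S : Set (N → ℂ)) :
    Set (N ⋊[φ] H → ℂ) :=
  {ξ | ∃ (ψ : N → ℂ) (hψ : IsIrreducibleCharacter ψ), ψ ∈ S ∧
    ∃ θ ∈ A.inducedSupercharacters ψ hψ, ξ = semidirectChar φ ψ θ}

end Semidirect

/-! ### Characters as sums of irreducible characters, and orthogonality -/

section Characters

open Module

variable {G : Type*} [Group G]

/-! A supercharacter theory is encoded in the linear span of its supercharacters: by a dimension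
count this span is the space of all superclass functions (`span_supercharacters`). Hence the
supercharacters determine the theory, and `T'` is coarser than `T` as soon as the supercharacters of
`T'` lie in the span of those of `T`. Conversely, pairwise orthogonal characters whose span is a
unital algebra under pointwise product and contains the indicator of the identity are the
supercharacters of some theory (`exists_of_span`).

To apply this to `N ⋊ H`, each `ψ ⋊ χ` is written, up to a nonzero scalar, as the sum of all
conjugates of the function `(n, h) ↦ ψ n * χ h`, with `χ` extended by zero
(`semidirectChar_eq_conjSum`). A product of two such sums is again a sum of such sums. By (H4) and
restriction, each term lives on a subgroup `H_ψ ∩ H_η` of `H_{ψη}`. Induction in stages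
(`conjSum_mem_span_of_le`) moves it up to `H_{ψη}`, back into the span. This gives existence.

The comparison uses the same lemma. A supercharacter of `H'_ψ` is a superclass function for the
finer theory on `H'_ψ`, and `H'_ψ ≤ H_ψ`, so `ψ ⋊ χ` lies in the span attached to `(𝓛, H_ψ)`. -/

theorem Representation.exists_equiv_fin {V : Type*} [AddCommGroup V] [Module ℂ V]
    [FiniteDimensional ℂ V] (ρ : Representation ℂ G V) :
    ∃ σ : Representation ℂ G (Fin (finrank ℂ V) → ℂ), Nonempty (ρ.Equiv σ) := by
  let e : V ≃ₗ[ℂ] (Fin (finrank ℂ V) → ℂ) := (finBasis ℂ V).equivFun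
  let σ : Representation ℂ G (Fin (finrank ℂ V) → ℂ) :=
    { toFun := fun g => e.conj (ρ g)
      map_one' := by rw [map_one]; exact e.conj_id
      map_mul' := fun a b => by rw [map_mul]; exact e.conj_comp _ _ }
  refine ⟨σ, ⟨Representation.Equiv.mk e fun g => ?_⟩⟩
  ext v
  simp [σ, LinearEquiv.conj_apply]

theorem Representation.Equiv.isIrreducible {V W : Type*} [AddCommGroup V] [Module ℂ V]
    [AddCommGroup W] [Module ℂ W] {ρ : Representation ℂ G V} {σ : Representation ℂ G W}
    (e : ρ.Equiv σ) (h : ρ.IsIrreducible) : σ.IsIrreducible := by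
  rw [Representation.irreducible_iff_isSimpleModule_asModule] at h ⊢
  exact IsSimpleModule.congr (LinearEquiv.ofBijective
    (Representation.IntertwiningMap.equivLinearMapAsModule σ ρ e.symm.toIntertwiningMap)
    e.symm.toLinearEquiv.bijective)

theorem Representation.IsIrreducible.isIrreducibleCharacter {V : Type*} [AddCommGroup V]
    [Module ℂ V] [FiniteDimensional ℂ V] {ρ : Representation ℂ G V} (h : ρ.IsIrreducible) :
    IsIrreducibleCharacter ρ.character := by
  obtain ⟨σ, ⟨e⟩⟩ := ρ.exists_equiv_fin
  exact ⟨_, σ, e.isIrreducible h, (Representation.char_iso e).symm⟩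

theorem Representation.isCharacter {V : Type*} [AddCommGroup V] [Module ℂ V]
    [FiniteDimensional ℂ V] (ρ : Representation ℂ G V) (h : ρ.character 1 ≠ 0) :
    IsCharacter ρ.character := by
  obtain ⟨σ, ⟨e⟩⟩ := ρ.exists_equiv_fin
  refine ⟨_, Nat.pos_of_ne_zero fun h0 => h ?_, σ, (Representation.char_iso e).symm⟩
  rw [Representation.char_one, h0, Nat.cast_zero]

theorem Representation.nontrivial_of_isIrreducible {V : Type*} [AddCommGroup V] [Module ℂ V]
    {ρ : Representation ℂ G V} (h : ρ.IsIrreducible) : Nontrivial V := by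
  by_contra hV
  rw [not_nontrivial_iff_subsingleton] at hV
  exact h.toNontrivial.exists_pair_ne.elim fun a ⟨b, hab⟩ =>
    hab (SetLike.ext fun x => by
      rw [Subsingleton.elim x 0]
      exact ⟨fun _ => b.toSubmodule.zero_mem, fun _ => a.toSubmodule.zero_mem⟩)

theorem IsIrreducibleCharacter.apply_one_ne_zero {η : G → ℂ} (h : IsIrreducibleCharacter η) :
    η 1 ≠ 0 := by
  obtain ⟨n, ρ, hρ, rfl⟩ := h
  have := Representation.nontrivial_of_isIrreducible hρ
  rw [Representation.char_one]
  exact_mod_cast (finrank_pos (R := ℂ) (M := Fin n → ℂ)).ne'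

theorem IsCharacter.apply_one_ne_zero {χ : G → ℂ} (h : IsCharacter χ) : χ 1 ≠ 0 := by
  obtain ⟨n, hn, ρ, rfl⟩ := h
  rw [Representation.char_one]
  simpa using hn.ne'

theorem IsCharacter.conj_apply {χ : G → ℂ} (h : IsCharacter χ) (x g : G) :
    χ (g * x * g⁻¹) = χ x := by
  obtain ⟨n, hn, ρ, rfl⟩ := h
  exact ρ.char_conj x g

theorem Representation.character_eq_add_of_isCompl {V : Type*} [AddCommGroup V] [Module ℂ V]
    [FiniteDimensional ℂ V] {ρ : Representation ℂ G V} {A B : Subrepresentation ρ}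
    (h : IsCompl A.toSubmodule B.toSubmodule) :
    ρ.character = A.toRepresentation.character + B.toRepresentation.character := by
  ext g
  let e := Submodule.prodEquivOfIsCompl _ _ h
  have : ρ g = e.conj (LinearMap.prodMap (A.toRepresentation g) (B.toRepresentation g)) := by
    ext v
    obtain ⟨p, rfl⟩ := e.surjective v
    rw [LinearEquiv.conj_apply_apply, LinearEquiv.symm_apply_apply]
    simp only [LinearMap.prodMap_apply, e, Submodule.coe_prodEquivOfIsCompl', map_add]
    rfl
  simp only [Representation.character, Pi.add_apply]
  rw [this, LinearMap.trace_conj', LinearMap.trace_prodMap']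

/-- Complete reducibility, by induction on the dimension. A multiset records the multiplicities as
natural numbers, which is what positivity arguments need later. -/
theorem Representation.exists_multiset_sum_character [Finite G] {V : Type*} [AddCommGroup V]
    [Module ℂ V] [FiniteDimensional ℂ V] (ρ : Representation ℂ G V) :
    ∃ s : Multiset (G → ℂ), (∀ η ∈ s, IsIrreducibleCharacter η) ∧ s.sum = ρ.character := by
  induction hd : finrank ℂ V using Nat.strong_induction_on generalizing V with
  | _ d ih =>
  subst hd
  rcases subsingleton_or_nontrivial V with hV | hV
  · refine ⟨0, by simp, ?_⟩
    ext g
    simp [Representation.character, Subsingleton.elim (ρ g) 0]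
  have hnt : Nontrivial (Subrepresentation ρ) := by
    refine ⟨⊥, ⊤, fun h => ?_⟩
    obtain ⟨v, hv⟩ := exists_ne (0 : V)
    have : v ∈ (⊥ : Subrepresentation ρ).toSubmodule := by rw [h]; exact Submodule.mem_top
    exact hv ((Submodule.mem_bot ℂ).1 this)
  by_cases hirr : ρ.IsIrreducible
  · exact ⟨{ρ.character}, by simpa using hirr.isIrreducibleCharacter, by simp⟩
  · have : ∃ A : Subrepresentation ρ, A ≠ ⊥ ∧ A ≠ ⊤ := by
      by_contra! hA
      exact hirr ⟨fun a => or_iff_not_imp_left.2 (hA a)⟩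
    obtain ⟨A, hA, hA'⟩ := this
    -- Maschke's theorem, which supplies the complement below, needs `|G|` to be nonzero in `ℂ`.
    have : NeZero (Nat.card G : ℂ) := ⟨by exact_mod_cast Nat.card_pos.ne'⟩
    obtain ⟨B, hAB⟩ := exists_isCompl A
    have hc : IsCompl A.toSubmodule B.toSubmodule := by
      rw [isCompl_iff, disjoint_iff, codisjoint_iff]
      exact ⟨congrArg Subrepresentation.toSubmodule hAB.inf_eq_bot,
        congrArg Subrepresentation.toSubmodule hAB.sup_eq_top⟩
    have hB : B ≠ ⊤ := by
      rintro rfl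
      exact hA (by simpa using hAB.inf_eq_bot)
    obtain ⟨s, hs, hs'⟩ := ih _ (Submodule.finrank_lt (s := A.toSubmodule)
      fun h => hA' (Subrepresentation.toSubmodule_injective h)) A.toRepresentation rfl
    obtain ⟨t, ht, ht'⟩ := ih _ (Submodule.finrank_lt (s := B.toSubmodule)
      fun h => hB (Subrepresentation.toSubmodule_injective h)) B.toRepresentation rfl
    refine ⟨s + t, fun η hη => (Multiset.mem_add.1 hη).elim (hs η) (ht η), ?_⟩
    rw [Multiset.sum_add, hs', ht', Representation.character_eq_add_of_isCompl hc]

theorem charInner_eq_sum [Fintype G] (χ η : G → ℂ) :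
    charInner χ η = (Nat.card G : ℂ)⁻¹ * ∑ g : G, χ g * η g⁻¹ := by
  rw [charInner, finsum_eq_sum_of_fintype]

theorem charInner_comm (χ η : G → ℂ) : charInner χ η = charInner η χ := by
  rw [charInner, charInner, ← finsum_comp_equiv (Equiv.inv G)]
  simp [mul_comm]

theorem charInner_add_left [Finite G] (χ χ' η : G → ℂ) :
    charInner (χ + χ') η = charInner χ η + charInner χ' η := by
  have := Fintype.ofFinite G
  simp [charInner_eq_sum, add_mul, Finset.sum_add_distrib, mul_add]

theorem charInner_smul_left [Finite G] (c : ℂ) (χ η : G → ℂ) :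
    charInner (c • χ) η = c * charInner χ η := by
  have := Fintype.ofFinite G
  simp [charInner_eq_sum, mul_assoc, ← Finset.mul_sum, mul_left_comm]

/-- The scalar product with a fixed function, as a linear functional. -/
noncomputable def charInnerRight [Finite G] (η : G → ℂ) : (G → ℂ) →ₗ[ℂ] ℂ where
  toFun χ := charInner χ η
  map_add' χ χ' := charInner_add_left χ χ' η
  map_smul' c χ := charInner_smul_left c χ η

@[simp]
theorem charInnerRight_apply [Finite G] (η χ : G → ℂ) : charInnerRight η χ = charInner χ η := rfl

open scoped Classical in
theorem charInner_irreducible [Finite G] {η η' : G → ℂ} (h : IsIrreducibleCharacter η)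
    (h' : IsIrreducibleCharacter η') : charInner η η' = if η = η' then 1 else 0 := by
  have := Fintype.ofFinite G
  obtain ⟨n, ρ, hρ, rfl⟩ := h
  obtain ⟨m, σ, hσ, rfl⟩ := h'
  have hG : Invertible (Nat.card G : ℂ) := invertibleOfNonzero (by exact_mod_cast Nat.card_pos.ne')
  have key (k l : ℕ) (ρ : Representation ℂ G (Fin k → ℂ)) (σ : Representation ℂ G (Fin l → ℂ))
      (hρ : ρ.IsIrreducible) (hσ : σ.IsIrreducible) : charInner ρ.character σ.character =
        if Nonempty (σ.Equiv ρ) then 1 else 0 := by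
    rw [charInner_eq_sum, Representation.char_orthonormal]
  split_ifs with he
  · rw [← he, key _ _ _ _ hρ hρ, if_pos ⟨Representation.Equiv.refl ρ⟩]
  · rw [key _ _ _ _ hρ hσ, if_neg]
    rintro ⟨e⟩
    exact he (Representation.char_iso e).symm

theorem IsCharacter.exists_multiset [Finite G] {χ : G → ℂ} (h : IsCharacter χ) :
    ∃ s : Multiset (G → ℂ), s ≠ 0 ∧ (∀ η ∈ s, IsIrreducibleCharacter η) ∧ s.sum = χ := by
  have h1 := h.apply_one_ne_zero
  obtain ⟨n, hn, ρ, rfl⟩ := h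
  obtain ⟨s, hs, hs'⟩ := ρ.exists_multiset_sum_character
  refine ⟨s, ?_, hs, hs'⟩
  rintro rfl
  rw [← hs'] at h1
  exact h1 (by simp)

theorem charInner_multiset_sum [Finite G] (s : Multiset (G → ℂ)) (η : G → ℂ) :
    charInner s.sum η = (s.map fun θ => charInner θ η).sum := by
  rw [← charInnerRight_apply, map_multiset_sum]
  rfl

open scoped Classical in
theorem charInner_multiset_sum_irreducible [Finite G] {s : Multiset (G → ℂ)}
    (hs : ∀ η ∈ s, IsIrreducibleCharacter η) {η : G → ℂ} (h : IsIrreducibleCharacter η) :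
    charInner s.sum η = s.count η := by
  rw [charInner_multiset_sum, Multiset.map_congr rfl fun θ hθ => charInner_irreducible (hs θ hθ) h]
  clear hs
  induction s using Multiset.induction_on with
  | empty => simp
  | cons a s ih =>
    rw [Multiset.map_cons, Multiset.sum_cons, ih, Multiset.count_cons]
    simp only [eq_comm (a := η)]
    split_ifs <;> push_cast <;> ring

/-- The scalar product is a sum of products of multiplicities. These are natural numbers, so nothing
cancels. -/
theorem IsCharacter.charInner_ne_zero_iff [Finite G] {χ χ' : G → ℂ} (h : IsCharacter χ)
    (h' : IsCharacter χ') :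
    charInner χ χ' ≠ 0 ↔
      ∃ η, IsIrreducibleCharacter η ∧ IsConstituent η χ ∧ IsConstituent η χ' := by
  classical
  obtain ⟨s, hs0, hs, rfl⟩ := h.exists_multiset
  obtain ⟨t, ht0, ht, rfl⟩ := h'.exists_multiset
  have hst : charInner s.sum t.sum = ((t.map fun η => s.count η).sum : ℕ) := by
    rw [charInner_comm, charInner_multiset_sum, Multiset.map_congr rfl fun η hη =>
      (charInner_comm η s.sum).trans (charInner_multiset_sum_irreducible hs (ht η hη))]
    simp [Nat.cast_multiset_sum]
  rw [hst, Nat.cast_ne_zero, Ne, Multiset.sum_eq_zero_iff]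
  constructor
  · intro hne
    simp only [Multiset.mem_map, forall_exists_index, and_imp, forall_apply_eq_imp_iff₂,
      not_forall] at hne
    obtain ⟨η, hη, hc⟩ := hne
    refine ⟨η, ht η hη, ?_, ?_⟩
    · rw [IsConstituent, charInner_multiset_sum_irreducible hs (ht η hη)]
      exact_mod_cast hc
    · rw [IsConstituent, charInner_multiset_sum_irreducible ht (ht η hη)]
      exact_mod_cast (Multiset.count_pos.2 hη).ne'
  · rintro ⟨η, hη, h1, h2⟩ hall
    rw [IsConstituent, charInner_multiset_sum_irreducible hs hη] at h1
    rw [IsConstituent, charInner_multiset_sum_irreducible ht hη] at h2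
    have hmem : η ∈ t := Multiset.count_pos.1 (Nat.pos_of_ne_zero (by exact_mod_cast h2))
    exact h1 (by exact_mod_cast hall _ (Multiset.mem_map_of_mem _ hmem))

theorem IsCharacter.charInner_self_ne_zero [Finite G] {χ : G → ℂ} (h : IsCharacter χ) :
    charInner χ χ ≠ 0 := by
  classical
  rw [h.charInner_ne_zero_iff h]
  obtain ⟨s, hs0, hs, rfl⟩ := h.exists_multiset
  obtain ⟨η, hη⟩ := Multiset.exists_mem_of_ne_zero hs0
  have : IsConstituent η s.sum := by
    rw [IsConstituent, charInner_multiset_sum_irreducible hs (hs η hη)]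
    exact_mod_cast (Multiset.count_pos.2 hη).ne'
  exact ⟨η, hs η hη, this, this⟩

end Characters

/-! ### Induced class functions of characters are characters -/

section Induction

open Module

variable {G : Type*} [Group G]

/-- The space of functions `F : G → V` with `F (k x) = ρ k (F x)` for `k ∈ K`. -/
def coinducedSubmodule {K : Subgroup G} {V : Type*} [AddCommGroup V] [Module ℂ V]
    (ρ : Representation ℂ K V) : Submodule ℂ (G → V) where
  carrier := {F | ∀ (k : K) (x : G), F (k * x) = ρ k (F x)}
  add_mem' hF hF' k x := by simp [hF k x, hF' k x]
  zero_mem' k x := by simp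
  smul_mem' c F hF k x := by simp [hF k x]

/-- Right translation on functions on `G`. -/
def rightTranslation (V : Type*) [AddCommGroup V] [Module ℂ V] : Representation ℂ G (G → V) where
  toFun g := LinearMap.funLeft ℂ V (· * g)
  map_one' := by ext; simp [LinearMap.funLeft_apply]
  map_mul' a b := by ext; simp [LinearMap.funLeft_apply, mul_assoc]

theorem rightTranslation_apply {V : Type*} [AddCommGroup V] [Module ℂ V] (g : G) (F : G → V)
    (x : G) : rightTranslation V g F x = F (x * g) := rfl

theorem rightTranslation_mem {K : Subgroup G} {V : Type*} [AddCommGroup V] [Module ℂ V]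
    (ρ : Representation ℂ K V) (g : G) {F : G → V} (hF : F ∈ coinducedSubmodule ρ) :
    rightTranslation V g F ∈ coinducedSubmodule ρ := fun k x => by
  rw [rightTranslation_apply, mul_assoc, hF k, rightTranslation_apply]

/-- The representation by right translation on the functions `F` with `F (k x) = ρ k (F x)`. -/
def coinducedRepresentation {K : Subgroup G} {V : Type*} [AddCommGroup V] [Module ℂ V]
    (ρ : Representation ℂ K V) : Representation ℂ G (coinducedSubmodule ρ) where
  toFun g := (rightTranslation V g).restrict fun _ hF => rightTranslation_mem ρ g hF
  map_one' := by ext; simp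
  map_mul' a b := by ext; simp

/-- The averaging projection of `G → V` onto `coinducedSubmodule ρ`. -/
noncomputable def coinducedProjection {K : Subgroup G} [Fintype K] {V : Type*} [AddCommGroup V]
    [Module ℂ V] (ρ : Representation ℂ K V) : (G → V) →ₗ[ℂ] (G → V) where
  toFun F x := (Nat.card K : ℂ)⁻¹ • ∑ k : K, ρ k (F ((k : G)⁻¹ * x))
  map_add' F F' := by ext; simp [Finset.sum_add_distrib]
  map_smul' c F := by ext; simp [← Finset.smul_sum, smul_comm c]

theorem coinducedProjection_apply {K : Subgroup G} [Fintype K] {V : Type*} [AddCommGroup V]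
    [Module ℂ V] (ρ : Representation ℂ K V) (F : G → V) (x : G) :
    coinducedProjection ρ F x = (Nat.card K : ℂ)⁻¹ • ∑ k : K, ρ k (F ((k : G)⁻¹ * x)) := rfl

theorem coinducedProjection_mem {K : Subgroup G} [Fintype K] {V : Type*} [AddCommGroup V]
    [Module ℂ V] (ρ : Representation ℂ K V) (F : G → V) :
    coinducedProjection ρ F ∈ coinducedSubmodule ρ := fun l x => by
  rw [coinducedProjection_apply, coinducedProjection_apply, map_smul, map_sum]
  congr 1
  rw [← Equiv.sum_comp (Equiv.mulLeft l)]
  refine Finset.sum_congr rfl fun k _ => ?_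
  simp [mul_assoc]

theorem coinducedProjection_eq_self {K : Subgroup G} [Fintype K] {V : Type*} [AddCommGroup V]
    [Module ℂ V] (ρ : Representation ℂ K V) {F : G → V} (hF : F ∈ coinducedSubmodule ρ) :
    coinducedProjection ρ F = F := by
  ext x
  have (k : K) : ρ k (F ((k : G)⁻¹ * x)) = F x := by
    rw [← hF k, mul_inv_cancel_left]
  rw [coinducedProjection_apply]
  simp only [this, Finset.sum_const, Finset.card_univ, Fintype.card_eq_nat_card]
  rw [← Nat.cast_smul_eq_nsmul ℂ, smul_smul, inv_mul_cancel₀, one_smul]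
  exact_mod_cast Nat.card_pos.ne'

theorem trace_pi_pi {ι : Type*} [Fintype ι] [DecidableEq ι] {n : ℕ}
    (T : (ι → Fin n → ℂ) →ₗ[ℂ] (ι → Fin n → ℂ)) :
    LinearMap.trace ℂ _ T = ∑ x, ∑ i, T (Pi.single x (Pi.single i 1)) x i := by
  rw [LinearMap.trace_eq_matrix_trace ℂ (Pi.basis fun _ : ι => Pi.basisFun ℂ (Fin n)),
    Matrix.trace, Fintype.sum_sigma]
  simp [LinearMap.toMatrix_apply]

open scoped Classical in
theorem induce_apply [Fintype G] (K : Subgroup G) (f : K → ℂ) (g : G) :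
    induce K f g =
      (Nat.card K : ℂ)⁻¹ * ∑ x : G, if h : x * g * x⁻¹ ∈ K then f ⟨x * g * x⁻¹, h⟩ else 0 := by
  rw [induce, finsum_eq_sum_of_fintype]

/-- The invariant functions have no convenient basis, so the trace is taken on all of `G → V`, where
delta functions form one, after composing the translation with the averaging projection. -/
theorem coinducedRepresentation_character [Finite G] {K : Subgroup G} {n : ℕ}
    (ρ : Representation ℂ K (Fin n → ℂ)) :
    (coinducedRepresentation ρ).character = induce K ρ.character := by
  classical
  have := Fintype.ofFinite G
  ext g
  let T := rightTranslation (Fin n → ℂ) g ∘ₗ coinducedProjection ρ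
  have hT (F) : T F ∈ coinducedSubmodule ρ :=
    rightTranslation_mem ρ g (coinducedProjection_mem ρ F)
  -- The projection is the identity on the submodule, and `T` maps everything into it, so both
  -- traces agree.
  have hr : coinducedRepresentation ρ g = T.restrict fun F _ => hT F := by
    ext F : 2
    change rightTranslation _ g F.1 = rightTranslation _ g (coinducedProjection ρ F.1)
    rw [coinducedProjection_eq_self ρ F.2]
  rw [Representation.character, hr, LinearMap.trace_restrict_eq_of_forall_mem _ _ hT, trace_pi_pi,
    induce_apply, Finset.mul_sum]
  refine Finset.sum_congr rfl fun x _ => ?_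
  have hTx (i : Fin n) : T (Pi.single x (Pi.single i 1)) x i = (Nat.card K : ℂ)⁻¹ *
      ∑ k : K, if (k : G) = x * g * x⁻¹ then ρ k (Pi.single i 1) i else 0 := by
    change coinducedProjection ρ (Pi.single x (Pi.single i 1)) (x * g) i = _
    rw [coinducedProjection_apply, Pi.smul_apply, smul_eq_mul, Finset.sum_apply]
    congr 1
    refine Finset.sum_congr rfl fun k _ => ?_
    rw [Pi.single_apply]
    have : (k : G)⁻¹ * (x * g) = x ↔ (k : G) = x * g * x⁻¹ := by
      rw [inv_mul_eq_iff_eq_mul, eq_mul_inv_iff_mul_eq, eq_comm]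
    simp only [this]
    split_ifs <;> simp
  simp only [hTx]
  rw [← Finset.mul_sum, Finset.sum_comm]
  congr 1
  have hρ (k : K) : (∑ i : Fin n, ρ k (Pi.single i 1) i) = ρ.character k := by
    rw [Representation.character, LinearMap.trace_eq_matrix_trace ℂ (Pi.basisFun ℂ (Fin n)),
      Matrix.trace]
    simp
  split_ifs with h
  · rw [Finset.sum_eq_single ⟨_, h⟩]
    · simpa using hρ _
    · intro k _ hk
      simp [Subtype.ext_iff] at hk
      simp [hk]
    · simp
  · refine Finset.sum_eq_zero fun k _ => Finset.sum_eq_zero fun i _ => if_neg fun hk => ?_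
    exact h (hk ▸ k.2)

theorem IsCharacter.induce [Finite G] {K : Subgroup G} {χ : K → ℂ} (h : IsCharacter χ) :
    IsCharacter (induce K χ) := by
  classical
  have := Fintype.ofFinite G
  have h1 := h.apply_one_ne_zero
  obtain ⟨n, hn, ρ, rfl⟩ := h
  rw [← coinducedRepresentation_character]
  refine Representation.isCharacter _ ?_
  rw [coinducedRepresentation_character, induce_apply]
  have hx (x : G) : (if h : x * 1 * x⁻¹ ∈ K then ρ.character ⟨x * 1 * x⁻¹, h⟩ else 0) =
      ρ.character 1 := by
    rw [dif_pos (by simp)]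
    congr 1
    ext
    simp
  simp only [hx, Finset.sum_const, Finset.card_univ, nsmul_eq_mul]
  exact mul_ne_zero (inv_ne_zero (by exact_mod_cast Nat.card_pos.ne'))
    (mul_ne_zero (by exact_mod_cast Fintype.card_ne_zero) h1)

end Induction

/-! ### Supercharacter theories as algebras of functions -/

section SpanOfSupercharacters

open Module

variable {G : Type*}

theorem LinearIndependent.finrank_span_eq_ncard [Finite G] {X : Set (G → ℂ)}
    (h : LinearIndependent ℂ (fun χ : X => (χ : G → ℂ))) :
    X.Finite ∧ finrank ℂ (Submodule.span ℂ X) = X.ncard := by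
  have hfin : Finite X := h.finite
  have := Fintype.ofFinite X
  refine ⟨Set.toFinite X, ?_⟩
  rw [finrank_span_set_eq_card h, Set.ncard_eq_toFinset_card']

/-- The functions that are constant on the classes of an equivalence relation. -/
def invariantFunctions (r : Setoid G) : Submodule ℂ (G → ℂ) where
  carrier := {f | ∀ x y, r x y → f x = f y}
  add_mem' hf hf' x y h := by simp [hf x y h, hf' x y h]
  zero_mem' x y _ := rfl
  smul_mem' c f hf x y h := by simp [hf x y h]

theorem finrank_invariantFunctions [Finite G] (r : Setoid G) :
    finrank ℂ (invariantFunctions r) = r.classes.ncard := by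
  have := Fintype.ofFinite G
  have := Fintype.ofFinite (Quotient r)
  have hr : invariantFunctions r =
      LinearMap.range (LinearMap.funLeft ℂ ℂ (Quotient.mk r)) := by
    ext f
    constructor
    · exact fun hf => ⟨Quotient.lift f hf, by ext; rfl⟩
    · rintro ⟨f, rfl⟩ x y h
      exact congrArg f (Quotient.sound h)
  rw [hr, LinearMap.finrank_range_of_inj
    (LinearMap.funLeft_injective_of_surjective _ _ _ Quotient.mk_surjective),
    finrank_fintype_fun_eq_card, Fintype.card_eq_nat_card,
    Nat.card_congr (Setoid.quotientEquivClasses r)]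
  rfl

/-- A finite Stone–Weierstrass theorem: a unital algebra of functions on a finite set contains the
indicator of each class of points it does not separate. Finiteness makes closure under complex
conjugation unnecessary. -/
theorem Submodule.eq_invariantFunctions [Finite G] {F : Submodule ℂ (G → ℂ)} (hone : 1 ∈ F)
    (hmul : ∀ f ∈ F, ∀ f' ∈ F, f * f' ∈ F) {r : Setoid G}
    (hr : ∀ x y, r x y ↔ ∀ f ∈ F, f x = f y) : F = invariantFunctions r := by
  classical
  have := Fintype.ofFinite G
  refine le_antisymm (fun f hf x y h => (hr x y).1 h f hf) fun f hf => ?_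
  let A : Subalgebra ℂ (G → ℂ) := F.toSubalgebra hone fun f f' hf hf' => hmul f hf f' hf'
  have hsep (x y : G) : ∃ f ∈ A, (∀ z, r x z → f z = 1) ∧ (¬ r x y → f y = 0) := by
    by_cases h : r x y
    · exact ⟨1, A.one_mem, fun _ _ => rfl, fun h' => absurd h h'⟩
    · obtain ⟨f, hf, hxy⟩ : ∃ f ∈ F, f x ≠ f y := by
        by_contra! hall
        exact h ((hr x y).2 hall)
      refine ⟨(f x - f y)⁻¹ • (f - algebraMap ℂ (G → ℂ) (f y)),
        A.smul_mem (A.sub_mem hf (A.algebraMap_mem _)) _, fun z hz => ?_, fun _ => ?_⟩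
      · simp [← (hr x z).1 hz f hf, inv_mul_cancel₀ (sub_ne_zero.2 hxy)]
      · simp
  choose e heA he1 he0 using hsep
  -- The product over `y` of the separating functions `e x y` is the indicator of the class of `x`.
  have hind (x : G) : (fun z => if r x z then (1 : ℂ) else 0) ∈ A := by
    convert A.prod_mem (t := Finset.univ) (f := e x) fun y _ => heA x y using 1
    ext z
    rw [Finset.prod_apply]
    split_ifs with h
    · exact (Finset.prod_eq_one fun y _ => he1 x y z h).symm
    · exact (Finset.prod_eq_zero (f := fun y => e x y z) (Finset.mem_univ z) (he0 x z h)).symm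
  -- Summing over points counts each class once per element; the inverse of the class size corrects
  -- for this.
  have hsum : f = ∑ x, (f x * (∑ z, if r x z then (1 : ℂ) else 0)⁻¹) •
      fun z => if r x z then (1 : ℂ) else 0 := by
    ext z
    have hc (x : G) (h : r x z) : (∑ w, if r x w then (1 : ℂ) else 0) =
        ∑ w, if r w z then (1 : ℂ) else 0 :=
      Finset.sum_congr rfl fun w _ => if_congr
        ⟨fun hw => r.trans (r.symm hw) h, fun hw => r.trans h (r.symm hw)⟩ rfl rfl
    have hne : (∑ w, if r w z then (1 : ℂ) else 0) ≠ 0 := by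
      rw [Finset.sum_boole]
      exact_mod_cast (Finset.card_pos.2 ⟨z, by simp⟩).ne'
    rw [Finset.sum_apply]
    have hterm (x : G) : ((f x * (∑ z, if r x z then (1 : ℂ) else 0)⁻¹) •
        fun z => if r x z then (1 : ℂ) else 0) z =
        (f z * (∑ w, if r w z then (1 : ℂ) else 0)⁻¹) * if r x z then 1 else 0 := by
      rw [Pi.smul_apply, smul_eq_mul]
      split_ifs with h
      · rw [hc x h, hf x z h]
      · simp
    rw [Finset.sum_congr rfl fun x _ => hterm x, ← Finset.mul_sum, mul_assoc,
      inv_mul_cancel₀ hne, mul_one]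
  rw [hsum]
  exact F.sum_mem fun x _ => F.smul_mem _ (hind x)

variable [Group G]

theorem linearIndependent_of_charInner [Finite G] {X : Set (G → ℂ)}
    (hX : ∀ χ ∈ X, IsCharacter χ) (horth : ∀ χ ∈ X, ∀ χ' ∈ X, χ ≠ χ' → charInner χ χ' = 0) :
    LinearIndependent ℂ (fun χ : X => (χ : G → ℂ)) := by
  classical
  rw [linearIndependent_iff']
  intro s c hc χ hχ
  have h := congrArg (charInnerRight (χ : G → ℂ)) hc
  rw [map_zero, map_sum, Finset.sum_eq_single χ] at h
  · rw [map_smul, charInnerRight_apply, smul_eq_mul] at h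
    exact (mul_eq_zero.1 h).resolve_right (hX χ χ.2).charInner_self_ne_zero
  · intro θ _ hθ
    rw [map_smul, charInnerRight_apply, horth θ θ.2 χ χ.2 fun h => hθ (Subtype.ext h), smul_zero]
  · exact fun h => absurd hχ h

theorem charInner_single_one [Finite G] [DecidableEq G] (η : G → ℂ) :
    charInner (Pi.single 1 1) η = (Nat.card G : ℂ)⁻¹ * η 1 := by
  have := Fintype.ofFinite G
  rw [charInner_eq_sum, Finset.sum_eq_single 1] <;> simp +contextual

/-- The superclasses are the joint level sets of `X`. Orthogonality makes `X` independent, so its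
size is the dimension of the span, hence the number of level sets. Orthogonality also makes the
supercharacter containing a given irreducible unique. -/
theorem SupercharacterTheory.exists_of_span [Finite G] [DecidableEq G] {X : Set (G → ℂ)}
    (hX : ∀ χ ∈ X, IsCharacter χ) (horth : ∀ χ ∈ X, ∀ χ' ∈ X, χ ≠ χ' → charInner χ χ' = 0)
    (hone : 1 ∈ Submodule.span ℂ X) (hsingle : Pi.single 1 1 ∈ Submodule.span ℂ X)
    (hmul : ∀ f ∈ Submodule.span ℂ X, ∀ f' ∈ Submodule.span ℂ X, f * f' ∈ Submodule.span ℂ X) :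
    ∃ T : SupercharacterTheory G, T.supercharacters = X := by
  let r : Setoid G :=
    { r := fun x y => ∀ χ ∈ X, χ x = χ y
      iseqv := ⟨fun _ _ _ => rfl, fun h χ hχ => (h χ hχ).symm,
        fun h h' χ hχ => (h χ hχ).trans (h' χ hχ)⟩ }
  have hr (x y : G) : r x y ↔ ∀ f ∈ Submodule.span ℂ X, f x = f y := by
    refine ⟨fun h f hf => ?_, fun h χ hχ => h χ (Submodule.subset_span hχ)⟩
    have : Submodule.span ℂ X ≤ LinearMap.eqLocus (LinearMap.proj x) (LinearMap.proj y) :=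
      Submodule.span_le.2 fun χ hχ => h χ hχ
    exact this hf
  obtain ⟨hfin, hcard⟩ := (linearIndependent_of_charInner hX horth).finrank_span_eq_ncard
  rw [Submodule.eq_invariantFunctions hone hmul hr, finrank_invariantFunctions] at hcard
  refine ⟨⟨r.classes, X, Setoid.isPartition_classes r, ?_, hX, ?_, ?_, ?_⟩, rfl⟩
  · rintro _ ⟨y, rfl⟩ x hx g
    exact fun χ hχ => ((hX χ hχ).conj_apply x g).trans (hx χ hχ)
  · rw [← hfin.cast_ncard_eq, ← hcard, (Set.toFinite r.classes).cast_ncard_eq]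
  · rintro χ hχ _ ⟨z, rfl⟩ x hx y hy
    exact (hx χ hχ).trans (hy χ hχ).symm
  · intro η hη
    -- An irreducible orthogonal to `X` would be orthogonal to the indicator of the identity, whose
    -- product with `η` is `η 1 / |G|`.
    have hex : ∃ χ ∈ X, IsConstituent η χ := by
      by_contra! hall
      have : Submodule.span ℂ X ≤ LinearMap.ker (charInnerRight η) :=
        Submodule.span_le.2 fun χ hχ => not_not.1 (hall χ hχ)
      have h0 : charInner (Pi.single 1 1) η = 0 := this hsingle
      rw [charInner_single_one] at h0
      exact mul_ne_zero (inv_ne_zero (by exact_mod_cast Nat.card_pos.ne'))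
        hη.apply_one_ne_zero h0
    obtain ⟨χ, hχ, hηχ⟩ := hex
    refine ⟨χ, ⟨hχ, hηχ⟩, fun χ' ⟨hχ', hηχ'⟩ => ?_⟩
    by_contra hne
    exact ((hX χ' hχ').charInner_ne_zero_iff (hX χ hχ)).2 ⟨η, hη, hηχ', hηχ⟩
      (horth χ' hχ' χ hχ hne)

namespace SupercharacterTheory

/-- The equivalence relation whose classes are the superclasses. -/
def superclassSetoid (T : SupercharacterTheory G) : Setoid G :=
  Setoid.mkClasses T.superclasses T.isPartition.2

theorem classes_superclassSetoid (T : SupercharacterTheory G) :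
    T.superclassSetoid.classes = T.superclasses :=
  Setoid.classes_mkClasses _ T.isPartition

theorem superclassSetoid_iff (T : SupercharacterTheory G) {x y : G} :
    T.superclassSetoid x y ↔ ∃ C ∈ T.superclasses, x ∈ C ∧ y ∈ C := by
  rw [← T.classes_superclassSetoid]
  exact Setoid.rel_iff_exists_classes _

theorem isSuperclassFunction_iff (T : SupercharacterTheory G) (f : G → ℂ) :
    T.IsSuperclassFunction f ↔ f ∈ invariantFunctions T.superclassSetoid := by
  constructor
  · intro h x y hxy
    obtain ⟨C, hC, hx, hy⟩ := T.superclassSetoid_iff.1 hxy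
    exact h C hC x hx y hy
  · exact fun h C hC x hx y hy => h x y (T.superclassSetoid_iff.2 ⟨C, hC, hx, hy⟩)

theorem charInner_eq_zero [Finite G] (T : SupercharacterTheory G) {χ χ' : G → ℂ}
    (hχ : χ ∈ T.supercharacters) (hχ' : χ' ∈ T.supercharacters) (hne : χ ≠ χ') :
    charInner χ χ' = 0 := by
  by_contra h
  obtain ⟨η, hη, h1, h2⟩ :=
    ((T.isCharacter χ hχ).charInner_ne_zero_iff (T.isCharacter χ' hχ')).1 h
  exact hne ((T.existsUnique_constituent η hη).unique ⟨hχ, h1⟩ ⟨hχ', h2⟩)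

/-- One inclusion is constancy on superclasses. Equality follows because orthogonal supercharacters
are independent and there are as many of them as superclasses. -/
theorem span_supercharacters [Finite G] (T : SupercharacterTheory G) :
    Submodule.span ℂ T.supercharacters = invariantFunctions T.superclassSetoid := by
  obtain ⟨hfin, hcard⟩ := (linearIndependent_of_charInner T.isCharacter
    fun χ hχ χ' hχ' => T.charInner_eq_zero hχ hχ').finrank_span_eq_ncard
  refine Submodule.eq_of_le_of_finrank_eq (Submodule.span_le.2 fun χ hχ =>
    (T.isSuperclassFunction_iff χ).1 (T.constant χ hχ)) ?_
  rw [hcard, finrank_invariantFunctions, T.classes_superclassSetoid, Set.ncard, T.encard_eq,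
    Set.ncard]

theorem isSuperclassFunction_iff_mem_span [Finite G] (T : SupercharacterTheory G) (f : G → ℂ) :
    T.IsSuperclassFunction f ↔ f ∈ Submodule.span ℂ T.supercharacters := by
  rw [isSuperclassFunction_iff, span_supercharacters]

theorem superclassSetoid_iff_forall [Finite G] (T : SupercharacterTheory G) {x y : G} :
    T.superclassSetoid x y ↔ ∀ f ∈ Submodule.span ℂ T.supercharacters, f x = f y := by
  classical
  rw [span_supercharacters]
  refine ⟨fun h f hf => hf x y h, fun h => ?_⟩
  have := h (fun z => if T.superclassSetoid x z then 1 else 0) fun a b hab =>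
    if_congr ⟨fun h => T.superclassSetoid.trans h hab,
      fun h => T.superclassSetoid.trans h (T.superclassSetoid.symm hab)⟩ rfl rfl
  by_contra hxy
  simp [hxy] at this

theorem eq_of_supercharacters_eq [Finite G] {T U : SupercharacterTheory G}
    (h : T.supercharacters = U.supercharacters) : T = U := by
  refine SupercharacterTheory.ext ?_ h
  rw [← T.classes_superclassSetoid, ← U.classes_superclassSetoid]
  congr 1
  ext x y
  rw [superclassSetoid_iff_forall, superclassSetoid_iff_forall, h]

theorem IsCoarser.isSuperclassFunction {T T' : SupercharacterTheory G} (h : T'.IsCoarser T)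
    {f : G → ℂ} (hf : T'.IsSuperclassFunction f) : T.IsSuperclassFunction f := by
  intro D hD x hx y hy
  obtain ⟨C, hC, hDC⟩ := h D hD
  exact hf C hC x (hDC hx) y (hDC hy)

theorem isCoarser_of_supercharacters [Finite G] {T T' : SupercharacterTheory G}
    (h : T'.supercharacters ⊆ Submodule.span ℂ T.supercharacters) : T'.IsCoarser T := by
  intro D hD
  obtain ⟨x, hx⟩ := Setoid.nonempty_of_mem_partition T.isPartition hD
  obtain ⟨C, ⟨hC, hxC⟩, -⟩ := T'.isPartition.2 x
  refine ⟨C, hC, fun y hy => ?_⟩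
  have : T'.superclassSetoid x y := T'.superclassSetoid_iff_forall.2 fun f hf =>
    T.superclassSetoid_iff_forall.1 (T.superclassSetoid_iff.2 ⟨D, hD, hx, hy⟩) f
      (Submodule.span_le.2 h hf)
  exact this C hC hxC

end SupercharacterTheory

end SpanOfSupercharacters

/-! ### Sums of conjugates and extension by zero -/

section ConjugateSums

variable {G : Type*} [Group G]

/-- The function `F^z(g) = F(z g z⁻¹)`. -/
def conjTranslate (z : G) : (G → ℂ) →ₗ[ℂ] (G → ℂ) :=
  LinearMap.funLeft ℂ ℂ fun g => z * g * z⁻¹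

@[simp]
theorem conjTranslate_apply (z : G) (F : G → ℂ) (g : G) :
    conjTranslate z F g = F (z * g * z⁻¹) := rfl

/-- The sum of the conjugates of a function. -/
def conjSum [Fintype G] : (G → ℂ) →ₗ[ℂ] (G → ℂ) := ∑ x : G, conjTranslate x

theorem conjSum_apply [Fintype G] (F : G → ℂ) (g : G) :
    conjSum F g = ∑ x : G, F (x * g * x⁻¹) := by
  simp [conjSum]

theorem conjSum_conjTranslate [Fintype G] (z : G) (F : G → ℂ) :
    conjSum (conjTranslate z F) = conjSum F := by
  ext g
  rw [conjSum_apply, conjSum_apply,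
    ← Equiv.sum_comp (Equiv.mulLeft z) fun x => F (x * g * x⁻¹)]
  simp [mul_assoc]

/-- A Mackey-type formula: in the double sum over conjugators `x` and `y`, substituting `y = z * x`
leaves a common conjugation by `x`. -/
theorem conjSum_mul_conjSum [Fintype G] (F F' : G → ℂ) :
    conjSum F * conjSum F' = ∑ z : G, conjSum (F * conjTranslate z F') := by
  ext g
  simp only [Pi.mul_apply, Finset.sum_apply, conjSum_apply, conjTranslate_apply]
  rw [Finset.sum_comm, Finset.sum_mul]
  refine Finset.sum_congr rfl fun x _ => ?_
  rw [← Finset.mul_sum, ← Equiv.sum_comp (Equiv.mulRight x)]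
  simp [mul_assoc]

theorem sum_conjSum [Fintype G] (F : G → ℂ) :
    ∑ g, conjSum F g = Fintype.card G * ∑ g, F g := by
  simp only [conjSum_apply]
  rw [Finset.sum_comm]
  have (x : G) : ∑ g, F (x * g * x⁻¹) = ∑ g, F g := Equiv.sum_comp (MulAut.conj x).toEquiv F
  simp [this]

theorem charInner_conjSum [Fintype G] (F F' : G → ℂ) :
    charInner (conjSum F) (conjSum F') = ∑ z : G, ∑ g : G, F g * F' (z * g⁻¹ * z⁻¹) := by
  have h : (fun g => conjSum F' g⁻¹) = conjSum fun g => F' g⁻¹ := by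
    ext g
    simp [conjSum_apply, mul_assoc]
  have h' : ∑ g, conjSum F g * conjSum F' g⁻¹ =
      ∑ g, (conjSum F * conjSum fun g => F' g⁻¹) g := by
    rw [← h]
    rfl
  rw [charInner_eq_sum, h', conjSum_mul_conjSum]
  simp only [Finset.sum_apply]
  rw [Finset.sum_comm]
  simp only [sum_conjSum]
  rw [← Finset.mul_sum, Nat.card_eq_fintype_card, inv_mul_cancel_left₀]
  · simp [mul_assoc]
  · exact_mod_cast Fintype.card_ne_zero

open scoped Classical in
/-- The extension by zero of a function on a subgroup. -/
noncomputable def zeroExtend (K : Subgroup G) : (K → ℂ) →ₗ[ℂ] (G → ℂ) where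
  toFun f g := if h : g ∈ K then f ⟨g, h⟩ else 0
  map_add' f f' := by ext g; by_cases h : g ∈ K <;> simp [h]
  map_smul' c f := by ext g; by_cases h : g ∈ K <;> simp [h]

theorem zeroExtend_of_mem {K : Subgroup G} (f : K → ℂ) {g : G} (h : g ∈ K) :
    zeroExtend K f g = f ⟨g, h⟩ := dif_pos h

@[simp]
theorem zeroExtend_coe {K : Subgroup G} (f : K → ℂ) (k : K) : zeroExtend K f k = f k :=
  zeroExtend_of_mem f k.2

theorem zeroExtend_of_notMem {K : Subgroup G} (f : K → ℂ) {g : G} (h : g ∉ K) :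
    zeroExtend K f g = 0 := dif_neg h

theorem zeroExtend_conjFunction {K : Subgroup G} (f : K → ℂ) (z : G) :
    zeroExtend (conjSubgroup K z) (conjFunction f z) = conjTranslate z (zeroExtend K f) := by
  ext g
  by_cases h : g ∈ conjSubgroup K z
  · have h' : z * g * z⁻¹ ∈ K := h
    rw [zeroExtend_of_mem _ h, conjTranslate_apply, zeroExtend_of_mem _ h']
    rfl
  · have h' : z * g * z⁻¹ ∉ K := h
    rw [zeroExtend_of_notMem _ h, conjTranslate_apply, zeroExtend_of_notMem _ h']

theorem zeroExtend_restrict {K : Subgroup G} {F : G → ℂ} (h : ∀ g ∉ K, F g = 0) :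
    zeroExtend K (fun k => F k) = F := by
  ext g
  by_cases hg : g ∈ K
  · rw [zeroExtend_of_mem _ hg]
  · rw [zeroExtend_of_notMem _ hg, h g hg]

theorem induce_eq_conjSum [Fintype G] (K : Subgroup G) (f : K → ℂ) :
    induce K f = (Nat.card K : ℂ)⁻¹ • conjSum (zeroExtend K f) := by
  ext g
  rw [induce_apply, Pi.smul_apply, conjSum_apply, smul_eq_mul]
  rfl

/-- The sum of the conjugates of a function by the elements of a subgroup. -/
def conjSumOver (L : Subgroup G) [Fintype L] : (G → ℂ) →ₗ[ℂ] (G → ℂ) :=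
  ∑ x : L, conjTranslate (x : G)

theorem conjSumOver_apply (L : Subgroup G) [Fintype L] (F : G → ℂ) (g : G) :
    conjSumOver L F g = ∑ x : L, F (x * g * (x : G)⁻¹) := by
  simp [conjSumOver]

/-- Extension by zero places functions on different subgroups in the single space `G → ℂ`, where
induction is a sum of translates. -/
theorem zeroExtend_induceBetween {K L : Subgroup G} [Fintype L] (h : K ≤ L) (f : K → ℂ) :
    zeroExtend L (induceBetween h f) =
      (Nat.card K : ℂ)⁻¹ • conjSumOver L (zeroExtend K f) := by
  classical
  ext g
  rw [Pi.smul_apply, conjSumOver_apply, smul_eq_mul]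
  by_cases hg : g ∈ L
  · rw [zeroExtend_of_mem _ hg, induceBetween, induce_apply,
      Nat.card_congr (Subgroup.subgroupOfEquivOfLe h).toEquiv]
    rfl
  · rw [zeroExtend_of_notMem _ hg, Finset.sum_eq_zero, mul_zero]
    intro x _
    refine zeroExtend_of_notMem _ fun hx => hg ?_
    have := L.mul_mem (L.mul_mem (L.inv_mem x.2) (h hx)) x.2
    simpa [mul_assoc] using this

theorem charInner_eq_sum_zeroExtend [Fintype G] (K : Subgroup G) (f f' : K → ℂ) :
    (Nat.card K : ℂ) * charInner f f' = ∑ g, zeroExtend K f g * zeroExtend K f' g⁻¹ := by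
  classical
  have := Fintype.ofFinite K
  rw [charInner_eq_sum, mul_inv_cancel_left₀ (by exact_mod_cast Nat.card_pos.ne')]
  rw [← Finset.sum_subset (Finset.subset_univ (Finset.univ.map (Function.Embedding.subtype (· ∈ K))))]
  · rw [Finset.sum_map]
    refine Finset.sum_congr rfl fun k _ => ?_
    rw [Function.Embedding.subtype_apply, zeroExtend_coe, ← Subgroup.coe_inv, zeroExtend_coe]
  · intro g _ hg
    rw [zeroExtend_of_notMem _ fun h => hg (by simpa using h), zero_mul]

theorem IsCharacter.comp {G' : Type*} [Group G'] {χ : G → ℂ} (h : IsCharacter χ) (f : G' →* G) :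
    IsCharacter (χ ∘ f) := by
  obtain ⟨n, hn, ρ, rfl⟩ := h
  exact ⟨n, hn, ρ.comp f, rfl⟩

theorem IsCharacter.monoidHom_mul {χ : G → ℂ} (h : IsCharacter χ) (f : G →* ℂ) :
    IsCharacter (fun g => f g * χ g) := by
  obtain ⟨n, hn, ρ, rfl⟩ := h
  refine ⟨n, hn, ⟨⟨fun g => f g • ρ g, by simp⟩, fun a b => ?_⟩, ?_⟩
  · simp [smul_smul, mul_comm]
  · ext g
    exact (map_smul (LinearMap.trace ℂ _) (f g) (ρ g)).trans rfl

theorem IsCharacter.induceBetween [Finite G] {K L : Subgroup G} (hKL : K ≤ L) {χ : K → ℂ}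
    (h : IsCharacter χ) : IsCharacter (induceBetween hKL χ) :=
  (h.comp (Subgroup.subgroupOfEquivOfLe hKL).toMonoidHom).induce

end ConjugateSums

/-! ### Irreducible characters of a finite abelian group -/

section LinearCharacters

variable {N : Type*} [CommGroup N]

theorem isIrreducibleCharacter_iff_exists_monoidHom [Finite N] {ψ : N → ℂ} :
    IsIrreducibleCharacter ψ ↔ ∃ f : N →* ℂ, ψ = f := by
  constructor
  · rintro ⟨n, ρ, hρ, rfl⟩
    have h1 := Representation.IsIrreducible.finrank_eq_one_of_isMulCommutative ρ
    rw [Module.finrank_fin_fun] at h1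
    subst h1
    -- On a line every endomorphism is multiplication by its trace.
    have key (g : N) (v : Fin 1 → ℂ) : ρ g v = ρ.character g • v := by
      have h : ρ g v = ρ g (v 0 • Pi.single 0 1) := by
        congr 1
        ext i
        simp [Subsingleton.elim i 0]
      rw [Representation.character, LinearMap.trace_eq_matrix_trace ℂ (Pi.basisFun ℂ (Fin 1)), h]
      ext i
      simp [Subsingleton.elim i 0, Matrix.trace, mul_comm]
    refine ⟨⟨⟨ρ.character, by simp⟩, fun a b => ?_⟩, rfl⟩
    have := congrFun (key (a * b) 1) 0
    rw [map_mul, Module.End.mul_apply, key b, map_smul, key a] at this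
    simpa [mul_comm] using this.symm
  · rintro ⟨f, rfl⟩
    refine ⟨1, ⟨⟨fun g => f g • 1, by simp⟩, fun a b => by simp [smul_smul, mul_comm]⟩, ?_, ?_⟩
    · refine { exists_pair_ne := ⟨⊥, ⊤, fun h => ?_⟩, eq_bot_or_eq_top := fun A => ?_ }
      · have : (⊥ : Submodule ℂ (Fin 1 → ℂ)) = ⊤ := congrArg Subrepresentation.toSubmodule h
        exact bot_ne_top this
      · have : IsSimpleOrder (Submodule ℂ (Fin 1 → ℂ)) :=
          is_simple_module_of_finrank_eq_one (Module.finrank_fin_fun ℂ)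
        exact (eq_bot_or_eq_top A.toSubmodule).imp
          (fun h => Subrepresentation.toSubmodule_injective h)
          (fun h => Subrepresentation.toSubmodule_injective h)
    · ext g
      exact (map_smul (LinearMap.trace ℂ _) (f g) _).trans (by simp)

namespace IsIrreducibleCharacter

variable [Finite N] {ψ η : N → ℂ}

theorem map_mul (h : IsIrreducibleCharacter ψ) (a b : N) : ψ (a * b) = ψ a * ψ b := by
  obtain ⟨f, rfl⟩ := isIrreducibleCharacter_iff_exists_monoidHom.1 h
  exact _root_.map_mul f a b

theorem map_one (h : IsIrreducibleCharacter ψ) : ψ 1 = 1 := by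
  obtain ⟨f, rfl⟩ := isIrreducibleCharacter_iff_exists_monoidHom.1 h
  exact _root_.map_one f

theorem mul (h : IsIrreducibleCharacter ψ) (h' : IsIrreducibleCharacter η) :
    IsIrreducibleCharacter (ψ * η) := by
  obtain ⟨f, rfl⟩ := isIrreducibleCharacter_iff_exists_monoidHom.1 h
  obtain ⟨f', rfl⟩ := isIrreducibleCharacter_iff_exists_monoidHom.1 h'
  exact isIrreducibleCharacter_iff_exists_monoidHom.2 ⟨f * f', rfl⟩

theorem comp (h : IsIrreducibleCharacter ψ) (e : N →* N) : IsIrreducibleCharacter (ψ ∘ e) := by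
  obtain ⟨f, rfl⟩ := isIrreducibleCharacter_iff_exists_monoidHom.1 h
  exact isIrreducibleCharacter_iff_exists_monoidHom.2 ⟨f.comp e, rfl⟩

variable (N) in
theorem one : IsIrreducibleCharacter (1 : N → ℂ) :=
  isIrreducibleCharacter_iff_exists_monoidHom.2 ⟨1, rfl⟩

end IsIrreducibleCharacter

theorem exists_sum_irreducible_eq_single [Finite N] [DecidableEq N] :
    ∃ s : Finset (N → ℂ), (∀ ψ ∈ s, IsIrreducibleCharacter ψ) ∧
      ∑ ψ ∈ s, ψ = (Nat.card N : ℂ) • Pi.single 1 1 := by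
  classical
  have := Fintype.ofFinite N
  have : Fintype (Additive N) := inferInstanceAs (Fintype N)
  let e : AddChar (Additive N) ℂ ↪ (N → ℂ) :=
    ⟨fun χ n => χ (Additive.ofMul n), fun χ χ' h => DFunLike.ext _ _ fun n => congrFun h n.toMul⟩
  refine ⟨Finset.univ.map e, ?_, ?_⟩
  · intro ψ hψ
    obtain ⟨χ, -, rfl⟩ := Finset.mem_map.1 hψ
    exact isIrreducibleCharacter_iff_exists_monoidHom.2
      ⟨⟨⟨fun n => χ (Additive.ofMul n), χ.map_zero_eq_one⟩,
        fun a b => χ.map_add_eq_mul (Additive.ofMul a) (Additive.ofMul b)⟩, rfl⟩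
  · ext n
    rw [Finset.sum_map, Finset.sum_apply]
    refine (AddChar.sum_apply_eq_ite (Additive.ofMul n)).trans ?_
    have : Additive.ofMul n = 0 ↔ n = 1 := Iff.rfl
    have hc : Fintype.card (Additive N) = Fintype.card N := Fintype.card_congr Additive.toMul
    simp [this, hc, Pi.single_apply]

end LinearCharacters

/-! ### Superclass functions of the members of a lattice -/

namespace CompatibleLattice

variable {H : Type*} [Group H] (𝓛 : CompatibleLattice H)

/-- The extensions by zero of the superclass functions of a member of the lattice. -/
noncomputable def superclassFunctions (K : Subgroup H) (hK : K ∈ 𝓛.lattice) :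
    Submodule ℂ (H → ℂ) :=
  (Submodule.span ℂ (𝓛.theory K hK).supercharacters).map (zeroExtend K)

variable {𝓛}

/-- `K'` is a variable with an equation because the lemma is applied where the conjugate of `K` is
known only propositionally. -/
theorem exists_supercharacter_conjTranslate {K K' : Subgroup H} {hK : K ∈ 𝓛.lattice}
    {hK' : K' ∈ 𝓛.lattice} {h : H} (hKK' : K' = conjSubgroup K h) {χ : K → ℂ}
    (hχ : χ ∈ (𝓛.theory K hK).supercharacters) :
    ∃ χ' ∈ (𝓛.theory K' hK').supercharacters,
      conjTranslate h (zeroExtend K χ) = zeroExtend K' χ' := by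
  subst hKK'
  exact ⟨_, 𝓛.conj_supercharacter K hK h χ hχ, (zeroExtend_conjFunction χ h).symm⟩

variable [Finite H]

theorem mem_superclassFunctions {K : Subgroup H} {hK : K ∈ 𝓛.lattice} {F : H → ℂ} :
    F ∈ 𝓛.superclassFunctions K hK ↔
      (∀ h ∉ K, F h = 0) ∧ (𝓛.theory K hK).IsSuperclassFunction fun k => F k := by
  constructor
  · rintro ⟨f, hf, rfl⟩
    refine ⟨fun h hh => zeroExtend_of_notMem f hh, ?_⟩
    simpa using ((𝓛.theory K hK).isSuperclassFunction_iff_mem_span f).2 hf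
  · rintro ⟨h0, h⟩
    exact ⟨_, ((𝓛.theory K hK).isSuperclassFunction_iff_mem_span _).1 h, zeroExtend_restrict h0⟩

theorem zeroExtend_mem_superclassFunctions {K : Subgroup H} {hK : K ∈ 𝓛.lattice} {f : K → ℂ}
    (h : (𝓛.theory K hK).IsSuperclassFunction f) :
    zeroExtend K f ∈ 𝓛.superclassFunctions K hK :=
  Submodule.mem_map_of_mem (((𝓛.theory K hK).isSuperclassFunction_iff_mem_span f).1 h)

theorem conjTranslate_mem {K K' : Subgroup H} {hK : K ∈ 𝓛.lattice} {hK' : K' ∈ 𝓛.lattice} {h : H}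
    (hKK' : K' = conjSubgroup K h) {F : H → ℂ} (hF : F ∈ 𝓛.superclassFunctions K hK) :
    conjTranslate h F ∈ 𝓛.superclassFunctions K' hK' := by
  subst hKK'
  obtain ⟨f, hf, rfl⟩ := hF
  suffices Submodule.span ℂ (𝓛.theory K hK).supercharacters ≤
      (𝓛.superclassFunctions _ hK').comap (conjTranslate h ∘ₗ zeroExtend K) from this hf
  refine Submodule.span_le.2 fun χ hχ => ?_
  change conjTranslate h (zeroExtend K χ) ∈ 𝓛.superclassFunctions _ hK'
  rw [← zeroExtend_conjFunction]
  exact zeroExtend_mem_superclassFunctions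
    ((𝓛.theory _ hK').constant _ (𝓛.conj_supercharacter K hK h χ hχ))

/-- The product is supported on the intersection, and both factors restrict to superclass functions
there. -/
theorem mul_mem {K L : Subgroup H} {hK : K ∈ 𝓛.lattice} {hL : L ∈ 𝓛.lattice} {F F' : H → ℂ}
    (hF : F ∈ 𝓛.superclassFunctions K hK) (hF' : F' ∈ 𝓛.superclassFunctions L hL) :
    F * F' ∈ 𝓛.superclassFunctions (K ⊓ L) (𝓛.lattice.infClosed hK hL) := by
  rw [mem_superclassFunctions] at hF hF' ⊢
  refine ⟨fun h hh => ?_, fun C hC x hx y hy => ?_⟩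
  · rw [Subgroup.mem_inf, not_and_or] at hh
    rcases hh with hh | hh
    · rw [Pi.mul_apply, hF.1 h hh, zero_mul]
    · rw [Pi.mul_apply, hF'.1 h hh, mul_zero]
  · exact congrArg₂ (· * ·)
      (𝓛.restrict_superclass _ K _ hK inf_le_left _ hF.2 C hC x hx y hy)
      (𝓛.restrict_superclass _ L _ hL inf_le_right _ hF'.2 C hC x hx y hy)

theorem conjSumOver_mem {K L : Subgroup H} [Fintype L] {hK : K ∈ 𝓛.lattice} {hL : L ∈ 𝓛.lattice}
    (hKL : K ≤ L) {F : H → ℂ} (hF : F ∈ 𝓛.superclassFunctions K hK) :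
    conjSumOver L F ∈ 𝓛.superclassFunctions L hL := by
  obtain ⟨f, hf, rfl⟩ := hF
  have hf' := 𝓛.induce_superclass K L hK hL hKL f
    (((𝓛.theory K hK).isSuperclassFunction_iff_mem_span f).2 hf)
  have h := Submodule.smul_mem _ (Nat.card K : ℂ) (zeroExtend_mem_superclassFunctions hf')
  rwa [zeroExtend_induceBetween, smul_smul, mul_inv_cancel₀, one_smul] at h
  exact_mod_cast Nat.card_pos.ne'

/-- Obtained by inducing from the trivial subgroup, which belongs to the lattice. -/
theorem single_one_mem [DecidableEq H] {K : Subgroup H} {hK : K ∈ 𝓛.lattice} :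
    (Pi.single 1 1 : H → ℂ) ∈ 𝓛.superclassFunctions K hK := by
  have := Fintype.ofFinite K
  have hbot : (Pi.single 1 1 : H → ℂ) ∈ 𝓛.superclassFunctions ⊥ 𝓛.bot_mem := by
    refine mem_superclassFunctions.2 ⟨fun h hh => ?_, fun C hC x hx y hy => ?_⟩
    · exact Pi.single_eq_of_ne (fun h1 => hh (Subgroup.mem_bot.2 h1)) _
    · rw [Subsingleton.elim x y]
  have h := conjSumOver_mem (hL := hK) bot_le hbot
  have he : conjSumOver K (Pi.single 1 1 : H → ℂ) = (Nat.card K : ℂ) • Pi.single 1 1 := by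
    ext g
    rw [conjSumOver_apply]
    have (x : K) : (x : H) * g * (x : H)⁻¹ = 1 ↔ g = 1 := by
      rw [mul_inv_eq_one, mul_eq_left]
    simp [Pi.single_apply, this]
  rw [he] at h
  exact (Submodule.smul_mem_iff _ (by exact_mod_cast Nat.card_pos.ne')).1 h

end CompatibleLattice

/-! ### The characters `ψ ⋊ χ` as sums of conjugates -/

section SemidirectCharacters

variable {N H : Type*} [CommGroup N] [Group H] {φ : H →* MulAut N}

variable (φ) in
/-- The function `(n, h) ↦ ψ(n) f(h)` on `N ⋊ H`. -/
def semidirectLift (ψ : N → ℂ) : (H → ℂ) →ₗ[ℂ] (N ⋊[φ] H → ℂ) where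
  toFun f g := ψ g.left * f g.right
  map_add' f f' := by ext; simp [mul_add]
  map_smul' c f := by ext; simp [mul_left_comm]

theorem semidirectLift_apply (ψ : N → ℂ) (f : H → ℂ) (g : N ⋊[φ] H) :
    semidirectLift φ ψ f g = ψ g.left * f g.right := rfl

theorem conjOnNormal_eq (ψ : N → ℂ) (g : N ⋊[φ] H) :
    conjOnNormal φ ψ g = ψ ∘ φ g.right := by
  ext n
  simp [conjOnNormal]

theorem conjTranslate_inr_semidirectLift (ψ : N → ℂ) (f : H → ℂ) (k : H) :
    conjTranslate (SemidirectProduct.inr k) (semidirectLift φ ψ f) =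
      semidirectLift φ (ψ ∘ φ k) (conjTranslate k f) := by
  ext g
  simp [semidirectLift_apply]

/-- Conjugation by the `N`-part of `z` contributes the values of `ψ` at `z.left` and `z.left⁻¹`.
They cancel on the inertia group, and outside it `f` vanishes. -/
theorem conjTranslate_semidirectLift [Finite N] {ψ : N → ℂ} (hψ : IsIrreducibleCharacter ψ)
    {f : H → ℂ} (hf : ∀ h ∉ inertia φ ψ, f h = 0) (z : N ⋊[φ] H) :
    conjTranslate z (semidirectLift φ ψ f) =
      semidirectLift φ (ψ ∘ φ z.right) (conjTranslate z.right f) := by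
  ext g
  simp only [conjTranslate_apply, semidirectLift_apply, SemidirectProduct.mul_left,
    SemidirectProduct.mul_right, SemidirectProduct.inv_left, SemidirectProduct.inv_right,
    Function.comp_apply]
  by_cases h : z.right * g.right * z.right⁻¹ ∈ inertia φ ψ
  · have h1 : ψ (φ (z.right * g.right) (φ z.right⁻¹ z.left⁻¹)) = ψ z.left⁻¹ := by
      rw [← MulAut.mul_apply, ← map_mul]
      exact h _
    rw [hψ.map_mul, hψ.map_mul, h1, mul_right_comm (ψ z.left), ← hψ.map_mul, mul_inv_cancel,
      hψ.map_one, one_mul]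
  · rw [hf _ h, mul_zero, mul_zero]

theorem semidirectLift_mul (ψ η : N → ℂ) (f f' : H → ℂ) :
    semidirectLift φ ψ f * semidirectLift φ η f' = semidirectLift φ (ψ * η) (f * f') := by
  ext g
  simp only [Pi.mul_apply, semidirectLift_apply]
  ring

/-- Elements of `L` fix `ψ`, so conjugating `f` by them conjugates the whole lift, which the full
sum does not see. This is induction in stages. -/
theorem conjSum_semidirectLift_conjSumOver [Fintype (N ⋊[φ] H)] {ψ : N → ℂ} {L : Subgroup H}
    [Fintype L] (hL : L ≤ inertia φ ψ) (f : H → ℂ) :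
    conjSum (semidirectLift φ ψ (conjSumOver L f)) =
      (Nat.card L : ℂ) • conjSum (semidirectLift φ ψ f) := by
  have h (x : L) : conjSum (semidirectLift φ ψ (conjTranslate (x : H) f)) =
      conjSum (semidirectLift φ ψ f) := by
    have hx : ψ ∘ φ (x : H) = ψ := funext (hL x.2)
    rw [← conjSum_conjTranslate (SemidirectProduct.inr (x : H)) (semidirectLift φ ψ f),
      conjTranslate_inr_semidirectLift, hx]
  rw [conjSumOver, LinearMap.sum_apply, map_sum, map_sum]
  simp only [h, Finset.sum_const, Finset.card_univ, ← Nat.cast_smul_eq_nsmul ℂ,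
    Fintype.card_eq_nat_card]

theorem card_comap_rightHom [Finite N] [Finite H] (K : Subgroup H) :
    Nat.card (K.comap (SemidirectProduct.rightHom : N ⋊[φ] H →* H)) = Nat.card N * Nat.card K := by
  rw [← Nat.card_prod]
  exact Nat.card_congr
    { toFun := fun g => (g.1.left, ⟨g.1.right, g.2⟩)
      invFun := fun p => ⟨⟨p.1, p.2.1⟩, p.2.2⟩
      left_inv := fun g => rfl
      right_inv := fun p => rfl }

theorem semidirectChar_eq_conjSum [Fintype (N ⋊[φ] H)] [Finite N] [Finite H] (ψ : N → ℂ)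
    {K : Subgroup H} (χ : K → ℂ) :
    semidirectChar φ ψ χ = ((Nat.card N : ℂ) * Nat.card K)⁻¹ •
      conjSum (semidirectLift φ ψ (zeroExtend K χ)) := by
  rw [semidirectChar, induce_eq_conjSum, card_comap_rightHom, Nat.cast_mul]
  congr 2
  ext g
  rw [semidirectLift_apply]
  by_cases h : g.right ∈ K
  · have h' : g ∈ K.comap SemidirectProduct.rightHom := h
    rw [zeroExtend_of_mem _ h, zeroExtend_of_mem _ h']
  · have h' : g ∉ K.comap SemidirectProduct.rightHom := h
    rw [zeroExtend_of_notMem _ h, zeroExtend_of_notMem _ h', mul_zero]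

theorem semidirectChar_induceBetween [Finite N] [Finite H] {ψ : N → ℂ} {K L : Subgroup H}
    (hKL : K ≤ L) (hL : L ≤ inertia φ ψ) (χ : K → ℂ) :
    semidirectChar φ ψ (induceBetween hKL χ) = semidirectChar φ ψ χ := by
  have : Finite (N ⋊[φ] H) := Finite.of_equiv _ SemidirectProduct.equivProd.symm
  have := Fintype.ofFinite (N ⋊[φ] H)
  have := Fintype.ofFinite L
  have hc : (Nat.card L : ℂ) ≠ 0 := by exact_mod_cast Nat.card_pos.ne'
  rw [semidirectChar_eq_conjSum, semidirectChar_eq_conjSum, zeroExtend_induceBetween, map_smul,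
    map_smul, conjSum_semidirectLift_conjSumOver hL, smul_smul, smul_smul]
  congr 1
  field_simp

/-- Since `K` fixes `ψ`, the map `nk ↦ ψ n` is multiplicative on `NK`. -/
theorem IsCharacter.semidirectChar [Finite N] [Finite H] {ψ : N → ℂ}
    (hψ : IsIrreducibleCharacter ψ) {K : Subgroup H} (hK : K ≤ inertia φ ψ) {χ : K → ℂ}
    (hχ : IsCharacter χ) : IsCharacter (semidirectChar φ ψ χ) := by
  have : Finite (N ⋊[φ] H) := Finite.of_equiv _ SemidirectProduct.equivProd.symm
  let K' := K.comap (SemidirectProduct.rightHom : N ⋊[φ] H →* H)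
  let p : K' →* K := (SemidirectProduct.rightHom.comp K'.subtype).codRestrict K fun g => g.2
  let f : K' →* ℂ :=
    { toFun := fun g => ψ g.1.left
      map_one' := hψ.map_one
      map_mul' := fun a b => by
        have := hK a.2 b.1.left
        simp only [Subgroup.coe_mul, SemidirectProduct.mul_left, hψ.map_mul]
        exact congrArg _ this }
  exact ((hχ.comp p).monoidHom_mul f).induce

end SemidirectCharacters

/-! ### The span of the constructed characters -/

section LittleGroups

variable {N H : Type*} [CommGroup N] [Group H] {φ : H →* MulAut N} {𝓛 : CompatibleLattice H}

namespace IsIrreducibleCharacter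

variable [Finite N] {ψ : N → ℂ}

theorem comp_mulAut (hψ : IsIrreducibleCharacter ψ) (e : MulAut N) :
    IsIrreducibleCharacter (ψ ∘ e) :=
  hψ.comp e.toMonoidHom

end IsIrreducibleCharacter

namespace LittleGroupChoice

variable (A : LittleGroupChoice φ 𝓛)

theorem subgroup_comp {ψ : N → ℂ} (hψ : IsIrreducibleCharacter ψ) (h : H) :
    A.subgroup (ψ ∘ φ h) = conjSubgroup (A.subgroup ψ) h := by
  rw [← A.conj ψ hψ h, conjOnNormal_eq, SemidirectProduct.right_inr]

variable [Finite N] [Finite H]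

theorem mem_characters_iff {S : Set (N → ℂ)} {ξ : N ⋊[φ] H → ℂ} :
    ξ ∈ A.characters S ↔ ∃ (ψ : N → ℂ) (hψ : IsIrreducibleCharacter ψ), ψ ∈ S ∧
      ∃ χ ∈ (𝓛.theory (A.subgroup ψ) (A.mem ψ hψ)).supercharacters,
        ξ = semidirectChar φ ψ χ := by
  constructor
  · rintro ⟨ψ, hψ, hS, _, ⟨χ, hχ, rfl⟩, rfl⟩
    exact ⟨ψ, hψ, hS, χ, hχ, semidirectChar_induceBetween _ le_rfl χ⟩
  · rintro ⟨ψ, hψ, hS, χ, hχ, rfl⟩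
    exact ⟨ψ, hψ, hS, _, ⟨χ, hχ, rfl⟩, (semidirectChar_induceBetween _ le_rfl χ).symm⟩

theorem isCharacter_of_mem {S : Set (N → ℂ)} {ξ : N ⋊[φ] H → ℂ} (hξ : ξ ∈ A.characters S) :
    IsCharacter ξ := by
  obtain ⟨ψ, hψ, -, χ, hχ, rfl⟩ := A.mem_characters_iff.1 hξ
  exact ((𝓛.theory _ (A.mem ψ hψ)).isCharacter χ hχ).semidirectChar hψ (A.le_inertia ψ hψ)

variable [Fintype (N ⋊[φ] H)] {S : Set (N → ℂ)}

theorem exists_of_mem {ξ : N ⋊[φ] H → ℂ} (hξ : ξ ∈ A.characters S) :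
    ∃ (ψ : N → ℂ) (hψ : IsIrreducibleCharacter ψ) (c : ℂ),
      ∃ F ∈ 𝓛.superclassFunctions (A.subgroup ψ) (A.mem ψ hψ),
        ξ = c • conjSum (semidirectLift φ ψ F) := by
  obtain ⟨ψ, hψ, -, χ, hχ, rfl⟩ := A.mem_characters_iff.1 hξ
  exact ⟨ψ, hψ, _, _, CompatibleLattice.zeroExtend_mem_superclassFunctions
    ((𝓛.theory _ (A.mem ψ hψ)).constant χ hχ), semidirectChar_eq_conjSum ψ χ⟩

/-- The sum of conjugates is unchanged by conjugation, so `ψ` may be moved to its orbit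
representative; (H2) and conjugation invariance of the theories carry `F` along. -/
theorem conjSum_mem_span (hS : IsOrbitTransversal φ S) {ψ : N → ℂ}
    (hψ : IsIrreducibleCharacter ψ) {F : H → ℂ}
    (hF : F ∈ 𝓛.superclassFunctions (A.subgroup ψ) (A.mem ψ hψ)) :
    conjSum (semidirectLift φ ψ F) ∈ Submodule.span ℂ (A.characters S) := by
  obtain ⟨ψ₀, ⟨hψ₀, g, hg⟩, -⟩ := hS.2 ψ hψ
  have hirr₀ := hS.1 ψ₀ hψ₀
  rw [conjOnNormal_eq] at hg
  have hψ₀' : ψ₀ = ψ ∘ φ g.right⁻¹ := by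
    rw [← hg]
    ext n
    simp
  have hF₀ : conjTranslate g.right⁻¹ F ∈ 𝓛.superclassFunctions (A.subgroup ψ₀) (A.mem ψ₀ hirr₀) :=
    CompatibleLattice.conjTranslate_mem (by rw [hψ₀', A.subgroup_comp hψ]) hF
  rw [← conjSum_conjTranslate (SemidirectProduct.inr g.right⁻¹),
    conjTranslate_inr_semidirectLift, ← hψ₀']
  generalize conjTranslate g.right⁻¹ F = F₀ at hF₀
  obtain ⟨f, hf, rfl⟩ := hF₀
  suffices Submodule.span ℂ (𝓛.theory _ (A.mem ψ₀ hirr₀)).supercharacters ≤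
      (Submodule.span ℂ (A.characters S)).comap
        (conjSum ∘ₗ semidirectLift φ ψ₀ ∘ₗ zeroExtend (A.subgroup ψ₀)) from this hf
  refine Submodule.span_le.2 fun χ hχ => ?_
  have hmem : semidirectChar φ ψ₀ χ ∈ Submodule.span ℂ (A.characters S) :=
    Submodule.subset_span (A.mem_characters_iff.2 ⟨ψ₀, hirr₀, hψ₀, χ, hχ, rfl⟩)
  rw [semidirectChar_eq_conjSum] at hmem
  refine (Submodule.smul_mem_iff (Submodule.span ℂ (A.characters S))
    (inv_ne_zero (mul_ne_zero ?_ ?_))).1 hmem <;>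
    exact_mod_cast Nat.card_pos.ne'

/-- Inducing `F` up to `H_ψ` changes the sum of conjugates only by a nonzero scalar. Both closure
under products and the final comparison rest on this. -/
theorem conjSum_mem_span_of_le (hS : IsOrbitTransversal φ S) {ψ : N → ℂ}
    (hψ : IsIrreducibleCharacter ψ) {K : Subgroup H} {hK : K ∈ 𝓛.lattice}
    (hle : K ≤ A.subgroup ψ) {F : H → ℂ} (hF : F ∈ 𝓛.superclassFunctions K hK) :
    conjSum (semidirectLift φ ψ F) ∈ Submodule.span ℂ (A.characters S) := by
  have := Fintype.ofFinite (A.subgroup ψ)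
  have h := A.conjSum_mem_span hS hψ (CompatibleLattice.conjSumOver_mem hle hF)
  rw [conjSum_semidirectLift_conjSumOver (A.le_inertia ψ hψ)] at h
  exact (Submodule.smul_mem_iff _ (by exact_mod_cast Nat.card_pos.ne')).1 h

theorem mul_mem_span (hS : IsOrbitTransversal φ S) {ξ ξ' : N ⋊[φ] H → ℂ}
    (hξ : ξ ∈ Submodule.span ℂ (A.characters S)) (hξ' : ξ' ∈ Submodule.span ℂ (A.characters S)) :
    ξ * ξ' ∈ Submodule.span ℂ (A.characters S) := by
  have hgen {ξ ξ' : N ⋊[φ] H → ℂ} (hξ : ξ ∈ A.characters S) (hξ' : ξ' ∈ A.characters S) :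
      ξ * ξ' ∈ Submodule.span ℂ (A.characters S) := by
    obtain ⟨ψ, hψ, c, F, hF, rfl⟩ := A.exists_of_mem hξ
    obtain ⟨η, hη, d, F', hF', rfl⟩ := A.exists_of_mem hξ'
    rw [smul_mul_smul_comm, conjSum_mul_conjSum]
    refine Submodule.smul_mem _ _ (Submodule.sum_mem _ fun z _ => ?_)
    have h0 (h : H) (hh : h ∉ inertia φ η) : F' h = 0 :=
      (CompatibleLattice.mem_superclassFunctions.1 hF').1 h fun h' => hh (A.le_inertia η hη h')
    have hη' := hη.comp_mulAut (φ z.right)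
    rw [conjTranslate_semidirectLift hη h0, semidirectLift_mul]
    exact A.conjSum_mem_span_of_le hS (hψ.mul hη') (A.inf_le ψ _ hψ hη')
      (CompatibleLattice.mul_mem hF (CompatibleLattice.conjTranslate_mem
        (hK' := A.mem _ hη') (A.subgroup_comp hη _) hF'))
  induction hξ using Submodule.span_induction with
  | mem ξ hξ =>
    induction hξ' using Submodule.span_induction with
    | mem ξ' hξ' => exact hgen hξ hξ'
    | zero => simp
    | add a b _ _ ha hb => rw [mul_add]; exact Submodule.add_mem _ ha hb
    | smul c a _ ha => rw [mul_smul_comm]; exact Submodule.smul_mem _ c ha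
  | zero => simp
  | add a b _ _ ha hb => rw [add_mul]; exact Submodule.add_mem _ ha hb
  | smul c a _ ha => rw [smul_mul_assoc]; exact Submodule.smul_mem _ c ha

theorem one_mem_span (hS : IsOrbitTransversal φ S) :
    1 ∈ Submodule.span ℂ (A.characters S) := by
  have h1 : (1 : H → ℂ) ∈
      𝓛.superclassFunctions (A.subgroup 1) (A.mem 1 (IsIrreducibleCharacter.one N)) := by
    refine CompatibleLattice.mem_superclassFunctions.2 ⟨fun h hh => absurd ?_ hh, ?_⟩
    · rw [A.one]; exact Subgroup.mem_top h
    · exact fun _ _ _ _ _ _ => rfl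
  have h := A.conjSum_mem_span hS (.one N) h1
  have he : conjSum (semidirectLift φ 1 (1 : H → ℂ)) =
      (Fintype.card (N ⋊[φ] H) : ℂ) • (1 : N ⋊[φ] H → ℂ) := by
    ext g
    simp [conjSum_apply, semidirectLift_apply]
  rw [he] at h
  exact (Submodule.smul_mem_iff _ (by exact_mod_cast Fintype.card_ne_zero)).1 h

/-- The irreducible characters of `N` sum to `|N|` times the indicator of the identity, and the
indicator of `1` in `H` is available in every `H_ψ`. -/
theorem single_one_mem_span [DecidableEq (N ⋊[φ] H)] (hS : IsOrbitTransversal φ S) :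
    Pi.single 1 1 ∈ Submodule.span ℂ (A.characters S) := by
  classical
  obtain ⟨s, hs, hsum⟩ := exists_sum_irreducible_eq_single (N := N)
  have hmem : ∑ ψ ∈ s, conjSum (semidirectLift φ ψ (Pi.single 1 1)) ∈
      Submodule.span ℂ (A.characters S) :=
    Submodule.sum_mem _ fun ψ hψ => A.conjSum_mem_span hS (hs ψ hψ)
      CompatibleLattice.single_one_mem
  have hlift : ∑ ψ ∈ s, semidirectLift φ ψ (Pi.single 1 1) =
      (Nat.card N : ℂ) • (Pi.single 1 1 : N ⋊[φ] H → ℂ) := by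
    ext g
    have hg := congrFun hsum g.left
    rw [Finset.sum_apply] at hg
    simp only [Finset.sum_apply, semidirectLift_apply, ← Finset.sum_mul, hg]
    simp only [Pi.smul_apply, Pi.single_apply, SemidirectProduct.ext_iff,
      SemidirectProduct.one_left, SemidirectProduct.one_right, smul_eq_mul]
    split_ifs <;> simp_all
  have hconj : conjSum (Pi.single 1 1 : N ⋊[φ] H → ℂ) =
      (Fintype.card (N ⋊[φ] H) : ℂ) • Pi.single 1 1 := by
    ext g
    have (x : N ⋊[φ] H) : x * g * x⁻¹ = 1 ↔ g = 1 := by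
      rw [mul_inv_eq_one, mul_eq_left]
    simp [conjSum_apply, Pi.single_apply, this]
  rw [← map_sum, hlift, map_smul, hconj] at hmem
  refine (Submodule.smul_mem_iff _ ?_).1 ((Submodule.smul_mem_iff _ ?_).1 hmem)
  · exact_mod_cast Fintype.card_ne_zero
  · exact_mod_cast Nat.card_pos.ne'

/-- If the scalar product is nonzero, some conjugator `z` contributes. Its term factors over `N` and
`H`, forcing `ψ` to be a conjugate of `η`, and `χ` the corresponding conjugate of `χ'`. -/
theorem charInner_eq_zero (hS : IsOrbitTransversal φ S) {ξ ξ' : N ⋊[φ] H → ℂ}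
    (hξ : ξ ∈ A.characters S) (hξ' : ξ' ∈ A.characters S) (hne : ξ ≠ ξ') :
    charInner ξ ξ' = 0 := by
  have := Fintype.ofFinite N
  have := Fintype.ofFinite H
  obtain ⟨ψ, hψ, hψS, χ, hχ, rfl⟩ := A.mem_characters_iff.1 hξ
  obtain ⟨η, hη, hηS, χ', hχ', rfl⟩ := A.mem_characters_iff.1 hξ'
  contrapose! hne
  rw [semidirectChar_eq_conjSum, semidirectChar_eq_conjSum, charInner_smul_left, charInner_comm,
    charInner_smul_left, charInner_comm, charInner_conjSum] at hne
  obtain ⟨z, -, hz⟩ := Finset.exists_ne_zero_of_sum_ne_zero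
    (right_ne_zero_of_mul (right_ne_zero_of_mul hne))
  have hη0 (h : H) (hh : h ∉ inertia φ η) : zeroExtend (A.subgroup η) χ' h = 0 :=
    zeroExtend_of_notMem _ fun h' => hh (A.le_inertia η hη h')
  set k := z.right
  set f := zeroExtend (A.subgroup ψ) χ
  set f' := zeroExtend (A.subgroup η) χ'
  -- The `N`-part of the inverse of `(n, h)` is `n⁻¹` twisted by `h⁻¹`. The twist disappears
  -- wherever the factor on `H` is nonzero, since there `k * h⁻¹ * k⁻¹` fixes `η`.
  have hinv (n : N) (h : H) : semidirectLift φ η f' (z * (⟨n, h⟩ : N ⋊[φ] H)⁻¹ * z⁻¹) =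
      (η ∘ φ k) n⁻¹ * conjTranslate k f' h⁻¹ := by
    have := congrFun (conjTranslate_semidirectLift hη hη0 z) (⟨n, h⟩ : N ⋊[φ] H)⁻¹
    rw [conjTranslate_apply] at this
    rw [this, semidirectLift_apply, SemidirectProduct.inv_left, SemidirectProduct.inv_right]
    by_cases hh : k * h⁻¹ * k⁻¹ ∈ inertia φ η
    · have h2 := hh (φ k n⁻¹)
      rw [← MulAut.mul_apply, ← map_mul, inv_mul_cancel_right, map_mul, MulAut.mul_apply] at h2
      simp only [Function.comp_apply]
      rw [h2]
    · rw [conjTranslate_apply, hη0 _ hh, mul_zero, mul_zero]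
  rw [← Equiv.sum_comp SemidirectProduct.equivProd.symm, Fintype.sum_prod_type] at hz
  have hprod : (∑ n : N, ψ n * (η ∘ φ k) n⁻¹) * (∑ h : H, f h * conjTranslate k f' h⁻¹) ≠ 0 := by
    refine fun h0 => hz ?_
    rw [← h0, Finset.sum_mul_sum]
    refine Finset.sum_congr rfl fun n _ => Finset.sum_congr rfl fun h _ => ?_
    change semidirectLift φ ψ f ⟨n, h⟩ * _ = _
    refine (congrArg _ (hinv n h)).trans ?_
    rw [semidirectLift_apply]
    ring
  have hψη : ψ = η ∘ φ k := by
    classical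
    have := charInner_irreducible hψ (hη.comp_mulAut (φ k))
    by_contra hne'
    rw [if_neg hne', charInner_eq_sum] at this
    exact left_ne_zero_of_mul hprod ((mul_eq_zero.1 this).resolve_left
      (inv_ne_zero (by exact_mod_cast Nat.card_pos.ne')))
  have hψη' : ψ = η := (hS.2 ψ hψ).unique
    ⟨hψS, 1, by rw [conjOnNormal_eq]; ext n; simp⟩
    ⟨hηS, z, by rw [conjOnNormal_eq, hψη]⟩
  subst hψη'
  -- Now `k` fixes `ψ`, so conjugation by `k` preserves `H_ψ` and permits comparing `χ` with the
  -- conjugate of `χ'` in one theory.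
  obtain ⟨χ'', hχ'', he⟩ := CompatibleLattice.exists_supercharacter_conjTranslate
    (hK' := A.mem ψ hψ) (h := k) (by rw [← A.subgroup_comp hψ, ← hψη]) hχ'
  have hsum := right_ne_zero_of_mul hprod
  rw [he, ← charInner_eq_sum_zeroExtend] at hsum
  have hχχ : χ = χ'' := by
    by_contra h
    exact right_ne_zero_of_mul hsum ((𝓛.theory _ (A.mem ψ hψ)).charInner_eq_zero hχ hχ'' h)
  rw [semidirectChar_eq_conjSum, semidirectChar_eq_conjSum, hχχ, ← he,
    ← conjSum_conjTranslate (SemidirectProduct.inr k) (semidirectLift φ ψ f'),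
    conjTranslate_inr_semidirectLift, ← hψη]

theorem exists_supercharacterTheory (hS : IsOrbitTransversal φ S) :
    ∃ T : SupercharacterTheory (N ⋊[φ] H), T.supercharacters = A.characters S := by
  classical
  exact SupercharacterTheory.exists_of_span (fun ξ hξ => A.isCharacter_of_mem hξ)
    (fun ξ hξ ξ' hξ' => A.charInner_eq_zero hS hξ hξ') (A.one_mem_span hS)
    (A.single_one_mem_span hS) fun f hf f' hf' => A.mul_mem_span hS hf hf'

end LittleGroupChoice

end LittleGroups

/-- If `𝓛' ⊆ 𝓛`, the theory of each `K ∈ 𝓛'` is coarser than its theory in `𝓛`, and `H'_ψ ≤ H_ψ` for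
all `ψ ∈ Irr(N)`, then the supercharacter theory `T'` of `G = N ⋊ H` built from `(𝓛', H'_ψ)` is coarser
than the supercharacter theory `T` built from `(𝓛, H_ψ)`. Here `T` and `T'` are the unique
supercharacter theories of `G` with the supercharacters `ψ ⋊ χ` of the construction, for any choice
of orbit representatives. -/
theorem mainTheorem6 {N H : Type*} [CommGroup N] [Group H] [Finite N] [Finite H]
    (φ : H →* MulAut N) (𝓛 𝓛' : CompatibleLattice H)
    (A : LittleGroupChoice φ 𝓛) (A' : LittleGroupChoice φ 𝓛')
    (hsub : 𝓛'.lattice ≤ 𝓛.lattice)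
    (hcoarser : ∀ (K : Subgroup H) (hK : K ∈ 𝓛'.lattice),
      (𝓛'.theory K hK).IsCoarser (𝓛.theory K (hsub hK)))
    (hle : ∀ ψ : N → ℂ, IsIrreducibleCharacter ψ → A'.subgroup ψ ≤ A.subgroup ψ)
    (S S' : Set (N → ℂ)) (hS : IsOrbitTransversal φ S) (hS' : IsOrbitTransversal φ S') :
    ∃ T T' : SupercharacterTheory (N ⋊[φ] H),
      (∀ U : SupercharacterTheory (N ⋊[φ] H), U.supercharacters = A.characters S ↔ U = T) ∧
      (∀ U : SupercharacterTheory (N ⋊[φ] H), U.supercharacters = A'.characters S' ↔ U = T') ∧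
      T'.IsCoarser T := by
  have : Finite (N ⋊[φ] H) := Finite.of_equiv _ SemidirectProduct.equivProd.symm
  have := Fintype.ofFinite (N ⋊[φ] H)
  obtain ⟨T, hT⟩ := A.exists_supercharacterTheory hS
  obtain ⟨T', hT'⟩ := A'.exists_supercharacterTheory hS'
  refine ⟨T, T',
    fun U => ⟨fun h => SupercharacterTheory.eq_of_supercharacters_eq (h.trans hT.symm), ?_⟩,
    fun U => ⟨fun h => SupercharacterTheory.eq_of_supercharacters_eq (h.trans hT'.symm), ?_⟩,
    SupercharacterTheory.isCoarser_of_supercharacters ?_⟩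
  · rintro rfl
    exact hT
  · rintro rfl
    exact hT'
  · rw [hT, hT']
    intro ξ hξ
    obtain ⟨ψ, hψ, -, χ, hχ, rfl⟩ := A'.mem_characters_iff.1 hξ
    have hK := A'.mem ψ hψ
    -- The theory passes from `𝓛'` to `𝓛` on the same subgroup `H'_ψ`; the enlargement to `H_ψ`
    -- happens in the last step.
    have hsf := (hcoarser _ hK).isSuperclassFunction ((𝓛'.theory _ hK).constant χ hχ)
    rw [semidirectChar_eq_conjSum]
    exact Submodule.smul_mem _ _ (A.conjSum_mem_span_of_le hS hψ (hle ψ hψ)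
      (CompatibleLattice.zeroExtend_mem_superclassFunctions hsf))
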